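/- Let $m$ be a positive integer and let $k$ be a positive odd integer with $\gcd(m,k)=1$. Let $f(x)=x^{(3^k+1)/2}$ on $\mathbb{F}_{3^m}$, let $\mathrm{Tr}$ be the absolute trace from $\mathbb{F}_{3^m}$ to $\mathbb{F}_3$, and let $$\mathcal{C}_f=\left\{\left(\left(\mathrm{Tr}(af(x)+bx)+c\right)_{x\in\mathbb{F}_{3^m}},\ \mathrm{Tr}(a)\right) : a,b\in\mathbb{F}_{3^m},\ c\in\mathbb{F}_3\right\}\subseteq\mathbb{F}_3^{3^m+1}.$$ An $[n,k',d]$ code is a linear code of length $n$, dimension $k'$ and minimum Hamming distance $d$; $A_i$ denotes the number of codewords of Hamming weight $i$; the dual is taken with respect to the standard inner product. In the weight distributions below, if several rows have the same weight, their multiplicities are added; all weights not listed have $A_i=0$. (1) If $m$ is odd, then $\mathcal{C}_f$ is a ternary $[3^m+1,\,2m+1]$ code. Its minimum distance is $2\cdot 3^{m-1}-3^{(m-1)/2}$ if $m\ge 3$, and $2$ if $m=1$. Its weight distribution is $$\begin{array}{c|c} \text{weight } i & A_i\\\hline 0 & 1\\ 3^m & 2\\ 2\cdot 3^{m-1} &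 3^{2m-1}+2\cdot 3^m-3\\ 2\cdot 3^{m-1}+1 & (3^m-3^{m-1})3^m\\ 2\cdot 3^{m-1}\pm 3^{(m-1)/2} & (3^{m-1}-1)3^m\\ 2\cdot 3^{m-1}\pm 3^{(m-1)/2}+1 & (3^m-3^{m-1})3^m \end{array}$$ where in the last two rows the stated multiplicity holds for each choice of sign. Its dual is a $[3^m+1,\,3^m-2m,\,4]$ code. (2) If $m$ is even, then $\mathcal{C}_f$ is a ternary $[3^m+1,\,2m+1,\,2\cdot 3^{m-1}-2\cdot 3^{(m-2)/2}]$ code with weight distribution $$\begin{array}{c|c} \text{weight } i & A_i\\\hline 0 & 1\\ 3^m & 2\\ 2\cdot 3^{m-1} & 3(3^m-1)\\ 2(3^{m-1}\pm 3^{(m-2)/2}) & (3^{2m-1}-3^m)/2\mp 3^{(3m-2)/2}\\ 2(3^{m-1}\pm 3^{(m-2)/2})+1 & 3^{2m-1}\pm 3^{(3m-2)/2}\\ 2\cdot 3^{m-1}\pm 3^{(m-2)/2} & 3^{2m-1}-3^m\pm 2\cdot 3^{(3m-2)/2}\\ 2\cdot 3^{m-1}\pm 3^{(m-2)/2}+1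 & 2\left(3^{2m-1}\mp 3^{(3m-2)/2}\right) \end{array}$$ where upper signs go with upper signs and lower signs with lower signs. Its dual is a $[3^m+1,\,3^m-2m,\,4]$ code. -/

import Mathlib

open Polynomial

/-- The code `C_f = {((Tr(a f(x) + b x) + c)_{x ∈ F}, Tr(a)) : a, b ∈ F, c ∈ 𝔽_p}` over `𝔽_p = ZMod p`,
where `Tr` is the absolute trace of `F`. The coordinates are indexed by `F ⊕ Unit`: the elements of
`F`, followed by one further position. -/
noncomputable def traceCode (p : ℕ) [Fact p.Prime] {F : Type*} [Field F] [Algebra (ZMod p) F]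
    (f : F → F) : Submodule (ZMod p) (F ⊕ Unit → ZMod p) where
  carrier := {w | ∃ (a b : F) (c : ZMod p),
    w = Sum.elim (fun x => Algebra.trace (ZMod p) F (a * f x + b * x) + c)
      (fun _ => Algebra.trace (ZMod p) F a)}
  zero_mem' := ⟨0, 0, 0, by ext (x | x) <;> simp⟩
  add_mem' := by
    rintro _ _ ⟨a, b, c, rfl⟩ ⟨a', b', c', rfl⟩
    refine ⟨a + a', b + b', c + c', ?_⟩
    ext (x | x)
    · simp only [Pi.add_apply, Sum.elim_inl, add_mul, map_add]
      ring
    · simp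
  smul_mem' := by
    rintro r _ ⟨a, b, c, rfl⟩
    refine ⟨r • a, r • b, r * c, ?_⟩
    ext (x | x)
    · simp [mul_add]
    · simp

/-- The dual code with respect to the standard inner product. -/
def dualCode {K ι : Type*} [Field K] [Fintype ι] (C : Submodule K (ι → K)) :
    Submodule K (ι → K) where
  carrier := {v | ∀ w ∈ C, ∑ i, v i * w i = 0}
  zero_mem' := by intro w _; simp
  add_mem' := by
    intro u v hu hv w hw
    simp [add_mul, Finset.sum_add_distrib, hu w hw, hv w hw]
  smul_mem' := by
    intro r v hv w hw
    simp [mul_assoc, ← Finset.mul_sum, hv w hw]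

/-- `C` has minimum Hamming distance `d`. -/
def HasMinDist {K ι : Type*} [Field K] [DecidableEq K] [Fintype ι]
    (C : Submodule K (ι → K)) (d : ℕ) : Prop :=
  IsLeast {e : ℕ | ∃ u ∈ C, ∃ v ∈ C, u ≠ v ∧ hammingDist u v = e} d

/-- `C` is an `[n, k]` linear code: length `n` and dimension `k`. -/
def IsLinearCode {K ι : Type*} [Field K] [Fintype ι]
    (C : Submodule K (ι → K)) (n k : ℕ) : Prop :=
  Fintype.card ι = n ∧ Module.finrank K C = k

/-- `A_i`, the number of codewords of Hamming weight `i` in `C`. -/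
noncomputable def weightCount {K ι : Type*} [Field K] [DecidableEq K] [Fintype ι]
    (C : Submodule K (ι → K)) (i : ℕ) : ℕ :=
  {w : ι → K | w ∈ C ∧ hammingNorm w = i}.ncard

/-- The weight enumerator `∑ A_i X ^ i` of a code, whose coefficients form its weight distribution. -/
noncomputable def weightEnumerator {K ι : Type*} [Field K] [DecidableEq K] [Fintype ι]
    (C : Submodule K (ι → K)) : ℚ[X] :=
  ∑ i ∈ Finset.range (Fintype.card ι + 1), Polynomial.C (weightCount C i : ℚ) * X ^ i

/-! Put q = 3^m, A = 3^(m-1) and d = (3^k+1)/2. The weight of the codeword of (a, b, c) is read off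
from the number of x with Tr(a x^d + b x) = -c, so everything rests on the deviations δ_0, δ_1, δ_2
of these level counts from their mean A.

The monomial x^d is planar (`isPlanar_pow`): in the coordinate x = -(z + 1/z) the difference (x+1)^d
- (x-1)^d becomes 2(z^e + z^(-e)), with e = d - 1 prime to q^2 - 1. For a ≠ 0 planarity fixes the
second moment of the level counts, which together with δ_0 + δ_1 + δ_2 = 0 says δ_0² + δ_0δ_1 + δ_1²
= A (`levelDev_sq`). This is a norm equation in the Eisenstein integers for a power of the ramified
prime 3, and it has six solutions. For m odd they are the permutations of (0, r, -r), so the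
contribution of (a, b) depends only on whether Tr a vanishes. For m even they are the arrangements
of ±(s, s, -2s), and the sign, carried by δ_0δ_1δ_2, must be counted separately over Tr a = 0 and Tr
a ≠ 0.

That count is a third moment. Triples whose values add up to zero detect δ_0δ_1δ_2
(`tripleCount_eq`). Summing over b leaves, up to a main term, the triples x, x+u, x-u; summing over
a then asks how often the second difference x^d + (x+u)^d + (x-u)^d is 0, 1 or -1. It is 0 only for
u = 0, by planarity; in general it is u^d times minus a square (`exists_sq_of_add_add_pow`), so when
-1 is a square each nonzero square is taken 2q times (`card_filter_add_add_eq`).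

Dual words are linear relations among the columns (f(x), x, 1) and (1, 0, 0). Planarity excludes a
relation on three points of F, while 0, 1, -1 and the extra position carry one of weight four. -/

/-- A function all of whose nontrivial difference maps are injective. -/
def IsPlanar {F : Type*} [Field F] (f : F → F) : Prop :=
  ∀ u, u ≠ 0 → Function.Injective fun x => f (x + u) - f x

/-! ### Arithmetic of the exponents -/

/-- Since k is prime to 2m, gcd(3^k - 1, 3^(2m) - 1) = 3 - 1 = 2; and e is odd because 3^k is 3 mod
4. -/
theorem coprime_half_three_pow_sub_one {m k e : ℕ} (hk : Odd k) (hmk : Nat.gcd m k = 1)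
    (he : 3 ^ k = 2 * e + 1) : Nat.Coprime e ((3 ^ m) ^ 2 - 1) := by
  have hodd : Odd e := by
    obtain ⟨j, rfl⟩ := hk
    have : (2 * e + 1) % 4 = 3 := by
      rw [← he, pow_succ, pow_mul, Nat.mul_mod, Nat.pow_mod]; norm_num
    rw [Nat.odd_iff]; omega
  have hg : Nat.gcd k (m * 2) = 1 := by
    have h1 : Nat.Coprime k m := by rw [Nat.coprime_comm]; exact hmk
    exact Nat.Coprime.mul_right h1 (Nat.coprime_two_right.2 hk)
  have h2 : Nat.gcd (3 ^ k - 1) (3 ^ (m * 2) - 1) = 2 := by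
    rw [Nat.pow_sub_one_gcd_pow_sub_one, hg]; norm_num
  have h3 : Nat.gcd e ((3 ^ m) ^ 2 - 1) ∣ 2 := by
    have := Nat.gcd_dvd_gcd_of_dvd_left (3 ^ (m * 2) - 1)
      (show e ∣ 3 ^ k - 1 from ⟨2, by rw [he]; omega⟩)
    rwa [h2, pow_mul] at this
  rcases (Nat.dvd_prime Nat.prime_two).1 h3 with h | h
  · exact h
  · exfalso
    have : 2 ∣ e := h ▸ Nat.gcd_dvd_left _ _
    rw [Nat.odd_iff] at hodd; omega

theorem even_half_three_pow_add_one {k d : ℕ} (hk : Odd k) (hd : 3 ^ k + 1 = 2 * d) : Even d := by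
  obtain ⟨j, rfl⟩ := hk
  have : (2 * d) % 4 = 0 := by
    rw [← hd, Nat.add_mod, pow_succ, pow_mul, Nat.mul_mod, Nat.pow_mod]; norm_num
  rw [Nat.even_iff]; omega

theorem eq_of_pow_eq_of_coprime {K : Type*} [Field K] {e n : ℕ} (hen : Nat.Coprime e n) {z w : K} (hw : w ≠ 0) (hzn : z ^ n = 1) (hwn : w ^ n = 1) (h : z ^ e = w ^ e) : z = w := by
  have h1 : (z / w) ^ Nat.gcd e n = 1 := by
    rw [pow_gcd_eq_one]
    constructor
    · rw [div_pow, h, div_self (pow_ne_zero _ hw)]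
    · rw [div_pow, hzn, hwn, div_one]
  rw [hen, pow_one] at h1
  exact (div_eq_one_iff_eq hw).1 h1

/-! ### Coulter–Matthews identities in characteristic 3 -/

section Field

variable {K : Type*} [Field K] [CharP K 3]

theorem three_eq_zero_of_charP : (3 : K) = 0 := by
  exact_mod_cast CharP.cast_eq_zero K 3

/-- The difference of a Coulter–Matthews power in the coordinate `x = -(z + z⁻¹)`. -/
theorem sub_pow_of_eq_add_inv {k d e : ℕ} (hd : 3 ^ k + 1 = 2 * d) (he : 3 ^ k = 2 * e + 1)
    (hev : Even d) {x z : K} (hz : z ≠ 0) (hx : x = -(z + z⁻¹)) :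
    (x + 1) ^ d - (x - 1) ^ d = 2 * (z ^ e + z⁻¹ ^ e) := by
  have h3 := three_eq_zero_of_charP (K := K)
  have hde : d = e + 1 := by omega
  -- In characteristic 3, z² ∓ z + 1 = (z ± 1)². The d-th power of a square is a power with exponent
  -- 3^k + 1, where Frobenius applies.
  have e1 : (x + 1) = -((z + 1) ^ 2 * z⁻¹) := by
    rw [hx]; field_simp; linear_combination (z) * h3
  have e2 : (x - 1) = -((z - 1) ^ 2 * z⁻¹) := by
    rw [hx]; field_simp; linear_combination (-z) * h3
  have f1 : (z + 1) ^ (2 * d) = (z ^ (2 * e + 1) + 1) * (z + 1) := by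
    rw [← hd, pow_succ, add_pow_char_pow, one_pow, he]
  have f2 : (z - 1) ^ (2 * d) = (z ^ (2 * e + 1) - 1) * (z - 1) := by
    rw [← hd, pow_succ, sub_pow_char_pow, one_pow, he]
  rw [e1, e2, hev.neg_pow, hev.neg_pow, mul_pow, mul_pow, ← pow_mul, ← pow_mul, f1, f2, hde,
    pow_succ, inv_pow, inv_pow]
  have hz' := pow_ne_zero e hz
  field_simp
  ring

/-- The second difference of a Coulter–Matthews power is minus a square. -/
theorem add_add_pow_eq_neg_sq {k d : ℕ} (hd : 3 ^ k + 1 = 2 * d) (hev : Even d) {x g r : K}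
    (hx : g * r = x) (hgr : g ^ 2 + r ^ 2 = -1) :
    x ^ d + (x + 1) ^ d + (x - 1) ^ d = -(g ^ d + r ^ d) ^ 2 := by
  have h3 := three_eq_zero_of_charP (K := K)
  have e1 : (x + 1) = -((g + r) ^ 2) := by
    linear_combination hgr - hx + g * r * h3
  have e2 : (x - 1) = (g - r) ^ 2 := by
    linear_combination -hx - hgr + g * r * h3
  have f1 : (g + r) ^ (2 * d) = (g ^ 3 ^ k + r ^ 3 ^ k) * (g + r) := by
    rw [← hd, pow_succ, add_pow_char_pow]
  have f2 : (g - r) ^ (2 * d) = (g ^ 3 ^ k - r ^ 3 ^ k) * (g - r) := by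
    rw [← hd, pow_succ, sub_pow_char_pow]
  have g1 : g ^ 3 ^ k * g = (g ^ d) ^ 2 := by rw [← pow_succ, hd, mul_comm, pow_mul]
  have r1 : r ^ 3 ^ k * r = (r ^ d) ^ 2 := by rw [← pow_succ, hd, mul_comm, pow_mul]
  rw [e1, e2, hev.neg_pow, ← pow_mul, ← pow_mul, f1, f2, ← hx, mul_pow]
  linear_combination 2 * g1 + 2 * r1 + ((g ^ d) ^ 2 + (r ^ d) ^ 2 + g ^ d * r ^ d) * h3

/-- The root g^d + r^d from `add_add_pow_eq_neg_sq` lies in K although g and r need not: d is even,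
so it is a power sum of g² and r², whose sum -1 and product x² are in K. -/
theorem exists_sq_of_add_add_pow {k d : ℕ} (hk : Odd k) (hd : 3 ^ k + 1 = 2 * d) (x : K) :
    ∃ g : K, x ^ d + (x + 1) ^ d + (x - 1) ^ d = -g ^ 2 := by
  have hev := even_half_three_pow_add_one hk hd
  let L := AlgebraicClosure K
  have : CharP L 3 := charP_of_injective_algebraMap (algebraMap K L).injective 3
  have h3 := three_eq_zero_of_charP (K := L)
  set y := algebraMap K L x with hy
  -- μ and ν are to be g + r and g - r; as 1/2 = -1, this gives g = -(μ + ν) and r = -(μ - ν).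
  obtain ⟨μ, hμ⟩ := IsAlgClosed.exists_pow_nat_eq (-(y + 1)) (n := 2) (by norm_num)
  obtain ⟨ν, hν⟩ := IsAlgClosed.exists_pow_nat_eq (y - 1) (n := 2) (by norm_num)
  set g := -(μ + ν) with hg
  set r := -(μ - ν) with hr
  have hgr : g * r = y := by
    rw [hg, hr]; linear_combination hμ - hν - y * h3
  have hgr2 : g ^ 2 + r ^ 2 = -1 := by
    rw [hg, hr]; linear_combination 2 * hμ + 2 * hν - h3
  have hrec : ∀ j : ℕ, ∃ c c' : K, algebraMap K L c = (g ^ 2) ^ j + (r ^ 2) ^ j ∧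
      algebraMap K L c' = (g ^ 2) ^ (j + 1) + (r ^ 2) ^ (j + 1) := by
    intro j
    induction j with
    | zero => exact ⟨2, -1, by rw [map_ofNat]; norm_num, by simp [hgr2]⟩
    | succ j ih =>
      obtain ⟨c, c', hc, hc'⟩ := ih
      refine ⟨c', -c' - x ^ 2 * c, hc', ?_⟩
      rw [map_sub, map_neg, map_mul, map_pow, hc, hc', ← hy, ← hgr]
      linear_combination (-((g ^ 2) ^ (j + 1) + (r ^ 2) ^ (j + 1))) * hgr2
  obtain ⟨j, hj⟩ := hev.two_dvd
  obtain ⟨c, -, hc, -⟩ := hrec j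
  refine ⟨c, (algebraMap K L).injective ?_⟩
  have := add_add_pow_eq_neg_sq hd hev hgr hgr2
  rw [← pow_mul, ← pow_mul, ← hj] at hc
  simpa [hc, ← hy] using this

end Field

/-! ### Planarity of the Coulter–Matthews monomial -/

section FiniteField

variable {F : Type*} [Field F] [Fintype F] [CharP F 3]

/-- z is a root of Z² + xZ + 1, whose coefficients are fixed by the q-Frobenius. Hence z^q is z or
1/z, and in both cases z^(q²) = z. -/
theorem exists_add_inv_eq {K : Type*} [Field K] [IsAlgClosed K] [Algebra F K] (x : F) :
    ∃ z : K, z ≠ 0 ∧ algebraMap F K x = -(z + z⁻¹) ∧ z ^ (Fintype.card F ^ 2 - 1) = 1 := by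
  have : CharP K 3 := charP_of_injective_algebraMap (algebraMap F K).injective 3
  obtain ⟨n, hp, hq⟩ := FiniteField.card F 3
  set y := algebraMap F K x with hy
  have h3 := three_eq_zero_of_charP (K := K)
  -- The discriminant is y² - 4 = y² - 1, and division by 2 is a change of sign.
  obtain ⟨r, hr⟩ := IsAlgClosed.exists_pow_nat_eq (y ^ 2 - 1) (n := 2) (by norm_num)
  have hz : (y + r) ^ 2 + y * (y + r) + 1 = 0 := by
    linear_combination hr + (y ^ 2 + y * r) * h3
  set z := y + r
  have hz0 : z ≠ 0 := by
    intro h; rw [h] at hz; simp at hz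
  have hq0 : 0 < Fintype.card F := Fintype.card_pos
  have hyq : y ^ Fintype.card F = y := by rw [hy, ← map_pow, FiniteField.pow_card]
  have hzq : (z ^ Fintype.card F) ^ 2 + y * z ^ Fintype.card F + 1 = 0 := by
    have := congrArg (· ^ Fintype.card F) hz
    simp only [hq] at this hyq ⊢
    rw [add_pow_char_pow, add_pow_char_pow, mul_pow, hyq, one_pow, ← pow_mul, mul_comm 2,
      pow_mul, zero_pow (by positivity)] at this
    exact this
  refine ⟨z, hz0, ?_, ?_⟩
  · field_simp; linear_combination hz
  · have hdisj : (z ^ Fintype.card F - z) * (z ^ Fintype.card F * z - 1) = 0 := by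
      linear_combination z * hzq - z ^ Fintype.card F * hz
    have : z ^ (Fintype.card F ^ 2) = z := by
      rcases mul_eq_zero.1 hdisj with h | h
      · rw [sq, pow_mul, sub_eq_zero.1 h, sub_eq_zero.1 h]
      · have h' : z ^ Fintype.card F = z⁻¹ := eq_inv_of_mul_eq_one_left (sub_eq_zero.1 h)
        rw [sq, pow_mul, h', inv_pow, h', inv_inv]
    have hpos : Fintype.card F ^ 2 - 1 + 1 = Fintype.card F ^ 2 :=
      Nat.sub_add_cancel (Nat.one_le_pow _ _ hq0)
    rw [← hpos, pow_succ] at this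
    exact mul_right_cancel₀ hz0 (by rw [this, one_mul])

/-- z^e + z^(-e) determines z^e up to inversion, hence z up to inversion because e is prime to q² -
1, hence x. -/
theorem sub_pow_injective {m k d : ℕ} (hF : Fintype.card F = 3 ^ m) (hk : Odd k)
    (hmk : Nat.gcd m k = 1) (hd : 3 ^ k + 1 = 2 * d) :
    Function.Injective fun x : F => (x + 1) ^ d - (x - 1) ^ d := by
  intro x y hxy
  have hev := even_half_three_pow_add_one hk hd
  obtain ⟨e, he⟩ : ∃ e, 3 ^ k = 2 * e + 1 := ⟨d - 1, by have := Nat.one_le_pow k 3 (by norm_num); omega⟩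
  let K := AlgebraicClosure F
  have : CharP K 3 := charP_of_injective_algebraMap (algebraMap F K).injective 3
  obtain ⟨z, hz, hx, hzn⟩ := exists_add_inv_eq (K := K) x
  obtain ⟨w, hw, hy, hwn⟩ := exists_add_inv_eq (K := K) y
  have hcop : Nat.Coprime e (Fintype.card F ^ 2 - 1) := by
    rw [hF]; exact coprime_half_three_pow_sub_one hk hmk he
  have key : 2 * (z ^ e + z⁻¹ ^ e) = 2 * (w ^ e + w⁻¹ ^ e) := by
    rw [← sub_pow_of_eq_add_inv hd he hev hz hx, ← sub_pow_of_eq_add_inv hd he hev hw hy]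
    have := congrArg (algebraMap F K) hxy
    simpa using this
  have h2 : (2 : K) ≠ 0 := by
    intro h
    have h3 := three_eq_zero_of_charP (K := K)
    exact one_ne_zero (by linear_combination h3 - h : (1 : K) = 0)
  have key := mul_left_cancel₀ h2 key
  apply (algebraMap F K).injective
  have hdisj : (z ^ e - w ^ e) * (z ^ e * w ^ e - 1) = 0 := by
    have hz' : z ^ e * z⁻¹ ^ e = 1 := by rw [← mul_pow, mul_inv_cancel₀ hz, one_pow]
    have hw' : w ^ e * w⁻¹ ^ e = 1 := by rw [← mul_pow, mul_inv_cancel₀ hw, one_pow]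
    linear_combination z ^ e * w ^ e * key - w ^ e * hz' + z ^ e * hw'
  rcases mul_eq_zero.1 hdisj with h | h
  · rw [hx, hy, eq_of_pow_eq_of_coprime hcop hw hzn hwn (sub_eq_zero.1 h)]
  · have : z ^ e = w⁻¹ ^ e := by
      rw [inv_pow]; exact eq_inv_of_mul_eq_one_left (sub_eq_zero.1 h)
    have := eq_of_pow_eq_of_coprime hcop (inv_ne_zero hw) hzn (by rw [inv_pow, hwn, inv_one]) this
    rw [hx, hy, this, inv_inv, add_comm]

/-- The Coulter–Matthews power function is planar. -/
theorem isPlanar_pow {m k d : ℕ} (hF : Fintype.card F = 3 ^ m) (hk : Odd k)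
    (hmk : Nat.gcd m k = 1) (hd : 3 ^ k + 1 = 2 * d) : IsPlanar fun x : F => x ^ d := by
  intro u hu x y hxy
  have h3 := three_eq_zero_of_charP (K := F)
  have hu' : -u ≠ 0 := neg_ne_zero.2 hu
  -- Rescaling to step 2 centred at 0: x + u and x are -u times X + 1 and X - 1 for X = (x -
  -- u)/(-u), since -2u = u.
  have key : ∀ x : F, (x + u) ^ d - x ^ d
      = (-u) ^ d * (((x - u) / (-u) + 1) ^ d - ((x - u) / (-u) - 1) ^ d) := by
    intro x
    rw [mul_sub, ← mul_pow, ← mul_pow]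
    have e1 : -u * ((x - u) / (-u) + 1) = x + u := by
      field_simp; linear_combination (-u) * h3
    have e2 : -u * ((x - u) / (-u) - 1) = x := by
      field_simp; ring
    rw [e1, e2]
  simp only [key] at hxy
  have := sub_pow_injective hF hk hmk hd (mul_left_cancel₀ (pow_ne_zero d hu') hxy)
  have := (div_left_inj' hu').1 this
  exact sub_left_injective this

end FiniteField

/-! ### Second differences of planar functions -/

section Planar

variable {F : Type*} [Field F] [CharP F 3] {f : F → F}

/-- As -1 = 2, a vanishing sum would say f(x+u) - f(x) = f(x) - f(x-u), a repeated value of the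
difference map. -/
theorem IsPlanar.add_add_ne_zero (hf : IsPlanar f) {u : F} (hu : u ≠ 0) (x : F) :
    f x + f (x + u) + f (x - u) ≠ 0 := by
  intro h
  have h3 := three_eq_zero_of_charP (K := F)
  have : x = x - u := hf u hu (by
    simp only [sub_add_cancel]
    linear_combination h - f x * h3)
  exact hu (sub_eq_self.1 this.symm)

theorem IsPlanar.eq_or_eq_neg (hf : IsPlanar f) (hev : ∀ x, f (-x) = f x) {x y : F}
    (h : f x = f y) : y = x ∨ y = -x := by
  have h3 := three_eq_zero_of_charP (K := F)
  by_cases hu : y - x = 0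
  · exact Or.inl (sub_eq_zero.1 hu)
  · right
    -- With u = y - x the difference map vanishes at x, and also at u, where it is f(2u) - f(u) =
    -- f(-u) - f(u).
    have : x = y - x := hf _ hu (by
      have e : y - x + (y - x) = -(y - x) := by linear_combination (y - x) * h3
      simp only [add_sub_cancel, e, hev, h, sub_self])
    linear_combination -this + x * h3 

/-- An even planar monomial takes every nonzero square as a value. -/
theorem exists_pow_eq_sq [Fintype F] {d : ℕ} (hd : Even d)
    (hf : IsPlanar fun x : F => x ^ d) (c : F) : ∃ u : F, u ^ d = c ^ 2 := by
  classical
  obtain ⟨j, hj⟩ := hd.two_dvd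
  let S : Finset F := Finset.univ.image fun x => x ^ 2
  -- For d = 2j, raising to the power j is an injective self-map of the finite set of squares, hence
  -- onto.
  have hmaps : Set.MapsTo (fun x : F => x ^ j) S S := by
    intro x hx
    obtain ⟨y, -, rfl⟩ := Finset.mem_image.1 (Finset.mem_coe.1 hx)
    exact Finset.mem_coe.2 (Finset.mem_image.2 ⟨y ^ j, Finset.mem_univ _, by ring⟩)
  have hinj : Set.InjOn (fun x : F => x ^ j) S := by
    intro x hx y hy hxy
    obtain ⟨x, -, rfl⟩ := Finset.mem_image.1 (Finset.mem_coe.1 hx)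
    obtain ⟨y, -, rfl⟩ := Finset.mem_image.1 (Finset.mem_coe.1 hy)
    simp only [← pow_mul, ← hj] at hxy
    rcases hf.eq_or_eq_neg (fun x => hd.neg_pow x) hxy with rfl | rfl <;> simp
  have hsurj := Finset.surjOn_of_injOn_of_card_le _ hmaps hinj le_rfl
  obtain ⟨y, hy, h⟩ := hsurj (Finset.mem_coe.2 (Finset.mem_image.2 ⟨c, Finset.mem_univ _, rfl⟩))
  obtain ⟨x, -, rfl⟩ := Finset.mem_image.1 (Finset.mem_coe.1 hy)
  exact ⟨x, by rw [hj, pow_mul]; exact h⟩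

theorem card_filter_pow_eq_sq [Fintype F] [DecidableEq F] {d : ℕ} (hd : Even d) (hd0 : d ≠ 0)
    (hf : IsPlanar fun x : F => x ^ d) {c : F} (hc : c ≠ 0) :
    (Finset.univ.filter fun u : F => u ^ d = c ^ 2).card = 2 := by
  have h3 := three_eq_zero_of_charP (K := F)
  obtain ⟨u, hu⟩ := exists_pow_eq_sq hd hf c
  have hu0 : u ≠ 0 := by
    rintro rfl
    rw [zero_pow hd0] at hu
    exact hc (pow_eq_zero_iff (two_ne_zero)|>.1 hu.symm)
  rw [Finset.card_eq_two]
  refine ⟨u, -u, fun h => hu0 (by linear_combination u * h3 - h), ?_⟩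
  ext v
  simp only [Finset.mem_filter, Finset.mem_univ, true_and, Finset.mem_insert,
    Finset.mem_singleton]
  constructor
  · intro hv
    exact hf.eq_or_eq_neg (fun x => hd.neg_pow x) (hu.trans hv.symm)
  · rintro (rfl | rfl)
    · exact hu
    · rw [hd.neg_pow, hu]

/-- Each nonzero square is taken twice on every line by the second difference of a
Coulter–Matthews monomial. -/
theorem card_filter_add_add_eq [Fintype F] [DecidableEq F] {k d : ℕ} (hk : Odd k)
    (hd : 3 ^ k + 1 = 2 * d) (hf : IsPlanar fun x : F => x ^ d) {i c : F} (hi : i ^ 2 = -1)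
    (hc : c ≠ 0) :
    (Finset.univ.filter fun p : F × F =>
      p.1 ^ d + (p.1 + p.2) ^ d + (p.1 - p.2) ^ d = c ^ 2).card = 2 * Fintype.card F := by
  have hev := even_half_three_pow_add_one hk hd
  have h3 := three_eq_zero_of_charP (K := F)
  have hd0 : d ≠ 0 := by rintro rfl; simp at hd
  have hi0 : i ≠ 0 := by rintro rfl; simp at hi
  -- On the line x = tu, homogeneity gives the value -u^d g² = u^d (ig)², so the condition is u^d =
  -- (c/(ig))².
  have key : ∀ t : F, (Finset.univ.filter fun u : F =>
      (t * u) ^ d + (t * u + u) ^ d + (t * u - u) ^ d = c ^ 2).card = 2 := by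
    intro t
    obtain ⟨g, hg⟩ := exists_sq_of_add_add_pow hk hd t
    have hg0 : g ≠ 0 := by
      rintro rfl
      exact hf.add_add_ne_zero one_ne_zero t (by simpa using hg)
    refine Eq.trans ?_ (card_filter_pow_eq_sq hev hd0 hf (c := c / (i * g))
      (div_ne_zero hc (mul_ne_zero hi0 hg0)))
    congr 1
    ext u
    simp only [Finset.mem_filter, Finset.mem_univ, true_and]
    have : (t * u) ^ d + (t * u + u) ^ d + (t * u - u) ^ d = u ^ d * (i * g) ^ 2 := by
      have e1 : t * u + u = (t + 1) * u := by ring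
      have e2 : t * u - u = (t - 1) * u := by ring
      rw [e1, e2, mul_pow, mul_pow, mul_pow]
      linear_combination u ^ d * hg - u ^ d * g ^ 2 * hi
    rw [this, div_pow, eq_div_iff (pow_ne_zero 2 (mul_ne_zero hi0 hg0))]
  rw [Finset.card_filter, Fintype.sum_prod_type_right]
  have h1 : ∀ u : F, (∑ x : F, if x ^ d + (x + u) ^ d + (x - u) ^ d = c ^ 2 then 1 else 0)
      = ∑ t : F, if (t * u) ^ d + (t * u + u) ^ d + (t * u - u) ^ d = c ^ 2 then 1 else 0 := by
    intro u
    -- For u = 0 the second difference is 3x^d = 0, so neither side counts anything; otherwise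
    -- substitute x = tu.
    by_cases hu : u = 0
    · subst hu
      have h0 : ∀ x : F, ¬ (x ^ d + (x + 0) ^ d + (x - 0) ^ d = c ^ 2) := by
        intro x h
        rw [add_zero, sub_zero] at h
        exact pow_ne_zero 2 hc (by linear_combination -h + x ^ d * h3)
      simp only [h0, if_false]
    · exact (Equiv.sum_comp (Equiv.mulRight₀ u hu) fun x =>
        if x ^ d + (x + u) ^ d + (x - u) ^ d = c ^ 2 then 1 else 0).symm
  simp only [h1]
  rw [Finset.sum_comm]
  simp only [← Finset.card_filter, key, Finset.sum_const, smul_eq_mul, Finset.card_univ, mul_comm]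

theorem card_filter_add_add_eq_zero [Fintype F] [DecidableEq F] (hf : IsPlanar f) :
    (Finset.univ.filter fun p : F × F =>
      f p.1 + f (p.1 + p.2) + f (p.1 - p.2) = 0).card = Fintype.card F := by
  have h3 := three_eq_zero_of_charP (K := F)
  have : (Finset.univ.filter fun p : F × F => f p.1 + f (p.1 + p.2) + f (p.1 - p.2) = 0)
      = Finset.univ ×ˢ {0} := by
    ext ⟨x, u⟩
    simp only [Finset.mem_filter, Finset.mem_univ, true_and, Finset.mem_product,
      Finset.mem_singleton]
    constructor
    · intro h
      by_contra hu
      exact hf.add_add_ne_zero hu x h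
    · rintro rfl
      rw [add_zero, sub_zero]
      linear_combination f x * h3
  rw [this, Finset.card_product, Finset.card_singleton, mul_one, Finset.card_univ]

end Planar

/-! ### Eisenstein norms equal to a power of 3 -/

/-- Descent by 3: from x² + xy + y² = (x - y)² + 3xy, divisibility by 9 forces 3 to divide x and y.
Norms 1 and 3 are checked by hand. -/
theorem int_sum_sq_three_pow (l : ℕ) : ∀ x y : ℤ,
    (x ^ 2 + x * y + y ^ 2 = 3 ^ (2 * l) →
      (x = 0 ∧ y = 3 ^ l) ∨ (x = 0 ∧ y = -3 ^ l) ∨ (x = 3 ^ l ∧ y = 0) ∨ (x = -3 ^ l ∧ y = 0) ∨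
      (x = 3 ^ l ∧ y = -3 ^ l) ∨ (x = -3 ^ l ∧ y = 3 ^ l)) ∧
    (x ^ 2 + x * y + y ^ 2 = 3 ^ (2 * l + 1) →
      (x = 3 ^ l ∧ y = 3 ^ l) ∨ (x = -3 ^ l ∧ y = -3 ^ l) ∨
      (x = -2 * 3 ^ l ∧ y = 3 ^ l) ∨ (x = 2 * 3 ^ l ∧ y = -3 ^ l) ∨
      (x = 3 ^ l ∧ y = -2 * 3 ^ l) ∨ (x = -3 ^ l ∧ y = 2 * 3 ^ l)) := by
  induction l with
  | zero =>
    intro x y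
    have hb : x ^ 2 + x * y + y ^ 2 ≤ 3 → -2 ≤ x ∧ x ≤ 2 ∧ -2 ≤ y ∧ y ≤ 2 := by
      intro h
      have hx : x ^ 2 ≤ 4 := by nlinarith [sq_nonneg (x + 2 * y)]
      have hy : y ^ 2 ≤ 4 := by nlinarith [sq_nonneg (2 * x + y)]
      refine ⟨?_, ?_, ?_, ?_⟩ <;> nlinarith
    constructor
    · intro h
      obtain ⟨h1, h2, h3, h4⟩ := hb (by rw [h]; norm_num)
      interval_cases x <;> interval_cases y <;> simp_all
    · intro h
      obtain ⟨h1, h2, h3, h4⟩ := hb (by rw [h]; norm_num)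
      interval_cases x <;> interval_cases y <;> simp_all
  | succ l ih =>
    intro x y
    have hdvd : (9 : ℤ) ∣ x ^ 2 + x * y + y ^ 2 → ∃ a b, x = 3 * a ∧ y = 3 * b := by
      rintro ⟨c, hc⟩
      have h1 : (3 : ℤ) ∣ x - y :=
        Int.prime_three.dvd_of_dvd_pow (n := 2) ⟨3 * c - x * y, by linear_combination hc⟩
      obtain ⟨e, he⟩ := h1
      have h2 : (3 : ℤ) ∣ y ^ 2 := by
        refine ⟨c - e ^ 2 - e * y, ?_⟩
        have : x = 3 * e + y := by linear_combination he
        subst this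
        linarith [hc]
      obtain ⟨b, hb⟩ := Int.prime_three.dvd_of_dvd_pow h2
      exact ⟨e + b, b, by linear_combination he + hb, hb⟩
    constructor
    · intro h
      obtain ⟨a, b, rfl, rfl⟩ := hdvd ⟨3 ^ (2 * l), by rw [h]; ring⟩
      have := (ih a b).1 (by
        have : (9 : ℤ) * (a ^ 2 + a * b + b ^ 2) = 9 * 3 ^ (2 * l) := by linear_combination h
        linarith)
      refine this.imp ?_ (Or.imp ?_ (Or.imp ?_ (Or.imp ?_ (Or.imp ?_ ?_)))) <;>
        (rintro ⟨rfl, rfl⟩; constructor <;> ring)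
    · intro h
      obtain ⟨a, b, rfl, rfl⟩ := hdvd ⟨3 ^ (2 * l + 1), by rw [h]; ring⟩
      have := (ih a b).2 (by
        have : (9 : ℤ) * (a ^ 2 + a * b + b ^ 2) = 9 * 3 ^ (2 * l + 1) := by linear_combination h
        linarith)
      refine this.imp ?_ (Or.imp ?_ (Or.imp ?_ (Or.imp ?_ (Or.imp ?_ ?_)))) <;>
        (rintro ⟨rfl, rfl⟩; constructor <;> ring)

theorem ZMod.sum_univ_three {M : Type*} [AddCommMonoid M] (g : ZMod 3 → M) :
    ∑ t, g t = g 0 + g 1 + g 2 := Fin.sum_univ_three g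

/-! ### Moments of level counts -/

section LevelCount

variable {X : Type*} [Fintype X]

/-- The number of points at which `L` takes the value `t`, as an integer. -/
def levelCount (L : X → ZMod 3) (t : ZMod 3) : ℤ := ∑ x, if L x = t then 1 else 0

theorem sum_comp_eq_sum_levelCount (L : X → ZMod 3) (g : ZMod 3 → ℤ) :
    ∑ x, g (L x) = ∑ t, levelCount L t * g t := by
  simp only [levelCount, Finset.sum_mul]
  rw [Finset.sum_comm]
  simp

theorem sum_levelCount (L : X → ZMod 3) : ∑ t, levelCount L t = Fintype.card X := by
  have := sum_comp_eq_sum_levelCount L fun _ => 1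
  simpa using this.symm

theorem sum_levelCount_sq (L : X → ZMod 3) :
    ∑ t, levelCount L t ^ 2 = ∑ x, ∑ y, if L y = L x then 1 else 0 := by
  rw [sum_comp_eq_sum_levelCount L fun t => ∑ y, if L y = t then 1 else 0]
  exact Finset.sum_congr rfl fun t _ => sq _

/-- Three elements of 𝔽₃ add up to zero exactly when they are all equal or all distinct. -/
theorem sum_triple_eq_levelCount (L : X → ZMod 3) :
    (∑ x, ∑ y, ∑ z, if L x + L y + L z = 0 then (1 : ℤ) else 0) =
      levelCount L 0 ^ 3 + levelCount L 1 ^ 3 + levelCount L 2 ^ 3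
        + 6 * (levelCount L 0 * levelCount L 1 * levelCount L 2) := by
  have h1 : ∀ s t : ZMod 3, (∑ z, if s + t + L z = 0 then (1 : ℤ) else 0)
      = levelCount L (-(s + t)) := by
    intro s t
    refine Finset.sum_congr rfl fun z _ => ?_
    simp only [eq_neg_iff_add_eq_zero, add_comm (L z)]
  have h2 : ∀ s : ZMod 3, (∑ y, levelCount L (-(s + L y)))
      = ∑ t, levelCount L t * levelCount L (-(s + t)) :=
    fun s => sum_comp_eq_sum_levelCount L fun t => levelCount L (-(s + t))
  simp only [h1, h2]
  rw [sum_comp_eq_sum_levelCount L fun s => ∑ t, levelCount L t * levelCount L (-(s + t))]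
  simp only [ZMod.sum_univ_three]
  have e00 : (-(0 + 0) : ZMod 3) = 0 := by decide
  have e01 : (-(0 + 1) : ZMod 3) = 2 := by decide
  have e02 : (-(0 + 2) : ZMod 3) = 1 := by decide
  have e10 : (-(1 + 0) : ZMod 3) = 2 := by decide
  have e11 : (-(1 + 1) : ZMod 3) = 1 := by decide
  have e12 : (-(1 + 2) : ZMod 3) = 0 := by decide
  have e20 : (-(2 + 0) : ZMod 3) = 1 := by decide
  have e21 : (-(2 + 1) : ZMod 3) = 0 := by decide
  have e22 : (-(2 + 2) : ZMod 3) = 2 := by decide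
  rw [e00, e01, e02, e10, e11, e12, e20, e21, e22]
  ring

end LevelCount

/-! ### Second and third moments of the trace forms -/

section Trace

variable {F : Type*} [Field F] [Fintype F] [Algebra (ZMod 3) F] {A : ℕ}

local notation "tr" => Algebra.trace (ZMod 3) F

theorem levelCount_trace (hA : Fintype.card F = 3 * A) (t : ZMod 3) :
    levelCount (fun x : F => tr x) t = A := by
  have h : ∀ t, levelCount (fun x : F => tr x) t = levelCount (fun x : F => tr x) 0 := by
    intro t
    obtain ⟨w, hw⟩ := Algebra.trace_surjective (ZMod 3) F t
    rw [levelCount, levelCount, ← Equiv.sum_comp (Equiv.addRight w)]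
    simp [hw]
  have hs := sum_levelCount (fun x : F => tr x)
  rw [ZMod.sum_univ_three, h 1, h 2, hA] at hs
  rw [h t]
  push_cast at hs
  linarith

theorem levelCount_trace_comp (hA : Fintype.card F = 3 * A) {g : F → F}
    (hg : Function.Injective g) (t : ZMod 3) : levelCount (fun x : F => tr (g x)) t = A := by
  rw [← levelCount_trace hA t]
  exact Equiv.sum_comp (Equiv.ofBijective g (Finite.injective_iff_bijective.1 hg))
    fun x => if tr x = t then (1 : ℤ) else 0

theorem levelCount_trace_mul [DecidableEq F] (hA : Fintype.card F = 3 * A) (c : F) :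
    levelCount (fun x : F => tr (x * c)) 0 = if c = 0 then (3 * A : ℤ) else A := by
  split_ifs with h
  · simp [levelCount, h, hA]
  · exact levelCount_trace_comp hA (mul_left_injective₀ h) 0

/-- The number of `a` with `Tr a = Tr (a c) = 0`, by counting over the four lines of `𝔽₃²`. -/
theorem three_mul_sum_trace_trace_mul [DecidableEq F] (hA : Fintype.card F = 3 * A) (c : F) :
    3 * (∑ a : F, if tr a = 0 then (if tr (a * c) = 0 then (1 : ℤ) else 0) else 0) =
      A + (if c = 0 then (3 * A : ℤ) else A) + (if c = -1 then (3 * A : ℤ) else A)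
        + (if c = 1 then (3 * A : ℤ) else A) - 3 * A := by
  -- At (0, 0) all four forms s, t, s + t, t - s vanish; at any other point exactly one does.
  have hp : ∀ s t : ZMod 3, (3 * if s = 0 then (if t = 0 then (1 : ℤ) else 0) else 0) =
      (if s = 0 then 1 else 0) + (if t = 0 then 1 else 0) + (if s + t = 0 then 1 else 0)
        + (if t - s = 0 then 1 else 0) - 1 := by decide
  have h1 := levelCount_trace hA 0
  have h2 := levelCount_trace_mul hA c
  have h3 := levelCount_trace_mul hA (1 + c)
  have h4 := levelCount_trace_mul hA (c - 1)
  simp only [levelCount] at h1 h2 h3 h4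
  rw [Finset.mul_sum]
  simp only [hp]
  rw [Finset.sum_sub_distrib, Finset.sum_add_distrib, Finset.sum_add_distrib,
    Finset.sum_add_distrib, h1, h2]
  have h3' : (∑ a : F, if tr a + tr (a * c) = 0 then (1 : ℤ) else 0)
      = if c = -1 then (3 * A : ℤ) else A := by
    simp only [← map_add]
    have e : (c = -1) = (1 + c = 0) := by
      rw [add_comm, eq_neg_iff_add_eq_zero]
    simp only [e, ← h3, mul_add, mul_one]
  have h4' : (∑ a : F, if tr (a * c) - tr a = 0 then (1 : ℤ) else 0)
      = if c = 1 then (3 * A : ℤ) else A := by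
    simp only [← map_sub]
    have e : (c = 1) = (c - 1 = 0) := by rw [sub_eq_zero]
    simp only [e, ← h4, mul_sub, mul_one]
  rw [h3', h4']
  simp [hA]

/-- The functions `x ↦ Tr (a f(x) + b x)`. -/
noncomputable def traceForm (f : F → F) (a b x : F) : ZMod 3 := tr (a * f x + b * x)

/-- Count pairs (x, x+u) with equal values: for u ≠ 0, planarity makes x ↦ a(f(x+u) - f(x)) + bu a
permutation, so its trace vanishes A times. -/
theorem sum_levelCount_sq_of_isPlanar (hA : Fintype.card F = 3 * A) {f : F → F} (hf : IsPlanar f)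
    {a : F} (ha : a ≠ 0) (b : F) :
    ∑ t, levelCount (traceForm f a b) t ^ 2 = 3 * A + (3 * A - 1) * A := by
  classical
  rw [sum_levelCount_sq]
  have h1 : ∀ x, (∑ y, if traceForm f a b y = traceForm f a b x then (1 : ℤ) else 0)
      = ∑ u, if tr (a * (f (x + u) - f x) + b * u) = 0 then 1 else 0 := by
    intro x
    rw [← Equiv.sum_comp (Equiv.addLeft x)]
    refine Finset.sum_congr rfl fun u _ => ?_
    simp only [Equiv.coe_addLeft, traceForm, ← sub_eq_zero (b := tr (a * f x + b * x)), ← map_sub]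
    congr 3
    ring_nf
  simp only [h1]
  rw [Finset.sum_comm]
  have h2 : ∀ u : F, (∑ x, if tr (a * (f (x + u) - f x) + b * u) = 0 then (1 : ℤ) else 0)
      = A + if u = 0 then (3 * A - A : ℤ) else 0 := by
    intro u
    split_ifs with hu
    · subst hu; simp [hA]
    · rw [add_zero]
      refine levelCount_trace_comp hA (g := fun x => a * (f (x + u) - f x) + b * u) ?_ 0
      intro x y hxy
      exact hf u hu (mul_left_cancel₀ ha (add_right_cancel hxy))
  simp only [h2]
  rw [Finset.sum_add_distrib]
  simp [hA]
  ring

/-- The deviation of a level count from its mean. -/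
noncomputable def levelDev (A : ℕ) (f : F → F) (a b : F) (t : ZMod 3) : ℤ :=
  levelCount (traceForm f a b) t - A

theorem levelDev_sum (hA : Fintype.card F = 3 * A) (f : F → F) (a b : F) :
    levelDev A f a b 0 + levelDev A f a b 1 + levelDev A f a b 2 = 0 := by
  have := sum_levelCount (traceForm f a b)
  rw [ZMod.sum_univ_three, hA] at this
  push_cast at this
  simp only [levelDev]
  linarith

theorem levelDev_sq (hA : Fintype.card F = 3 * A) {f : F → F} (hf : IsPlanar f)
    {a : F} (ha : a ≠ 0) (b : F) :
    levelDev A f a b 0 ^ 2 + levelDev A f a b 0 * levelDev A f a b 1 + levelDev A f a b 1 ^ 2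
      = A := by
  have h1 := sum_levelCount_sq_of_isPlanar hA hf ha b
  have h2 := levelDev_sum hA f a b
  rw [ZMod.sum_univ_three] at h1
  have h3 : levelDev A f a b 2 = -(levelDev A f a b 0 + levelDev A f a b 1) := by linarith
  simp only [levelDev] at *
  have h0 : levelCount (traceForm f a b) 2 = 3 * A - levelCount (traceForm f a b) 0
    - levelCount (traceForm f a b) 1 := by linarith
  rw [h0] at h1
  nlinarith

/-- The number of triples on which the values of the trace form add up to zero. -/
noncomputable def tripleCount (f : F → F) (a b : F) : ℤ :=
  ∑ x, ∑ y, ∑ z, if tr (a * (f x + f y + f z) + b * (x + y + z)) = 0 then 1 else 0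

/-- Once the deviations add up to zero, the linear and quadratic terms of the cubic moment cancel,
leaving their product. -/
theorem tripleCount_eq (hA : Fintype.card F = 3 * A) (f : F → F) (a b : F) :
    tripleCount f a b = 9 * A ^ 3
      + 9 * (levelDev A f a b 0 * levelDev A f a b 1 * levelDev A f a b 2) := by
  have h := sum_triple_eq_levelCount (traceForm f a b)
  have h1 := levelDev_sum hA f a b
  have h2 : tripleCount f a b = ∑ x, ∑ y, ∑ z,
      if traceForm f a b x + traceForm f a b y + traceForm f a b z = 0 then (1 : ℤ) else 0 := by
    simp only [tripleCount, traceForm, ← map_add]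
    refine Finset.sum_congr rfl fun x _ => Finset.sum_congr rfl fun y _ =>
      Finset.sum_congr rfl fun z _ => ?_
    rw [show a * (f x + f y + f z) + b * (x + y + z)
      = a * f x + b * x + (a * f y + b * y) + (a * f z + b * z) by ring]
  rw [h2, h]
  have e : ∀ t, levelCount (traceForm f a b) t = A + levelDev A f a b t := by
    intro t; simp only [levelDev]; ring
  have h3 : levelDev A f a b 2 = -(levelDev A f a b 0 + levelDev A f a b 1) := by linarith
  rw [e, e, e, h3]
  ring

/-- The number of pairs at which `Tr (a · )` kills the second difference of `f`. -/
noncomputable def diffCount (f : F → F) (a : F) : ℤ :=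
  ∑ x, ∑ u, if tr (a * (f x + f (x + u) + f (x - u))) = 0 then 1 else 0

/-- A triple with x + y + z ≠ 0 is counted for A values of b; the others have the form x, x+u, x-u
and do not depend on b. -/
theorem sum_tripleCount (hA : Fintype.card F = 3 * A) (f : F → F) (a : F) :
    ∑ b, tripleCount f a b = (3 * A) ^ 2 * (3 * A - 1) * A + 3 * A * diffCount f a := by
  classical
  have : CharP F 3 := charP_of_injective_algebraMap (algebraMap (ZMod 3) F).injective 3
  have h3 := three_eq_zero_of_charP (K := F)
  have h1 : ∀ x u z : F, (∑ b : F,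
      if tr (a * (f x + f (x + u) + f z) + b * (x + (x + u) + z)) = 0 then (1 : ℤ) else 0)
      = A + if z = x - u then
        ((if tr (a * (f x + f (x + u) + f (x - u))) = 0 then 3 * A else 0) - A : ℤ) else 0 := by
    intro x u z
    have hz : x + (x + u) + z = z - (x - u) := by linear_combination x * h3
    split_ifs with hzu htr
    · rw [hz, sub_eq_zero.2 hzu, hzu]; simp [htr, hA]
    · rw [hz, sub_eq_zero.2 hzu, hzu]; simp [htr]
    · rw [add_zero, hz]
      refine levelCount_trace_comp hA
        (g := fun b => a * (f x + f (x + u) + f z) + b * (z - (x - u))) ?_ 0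
      intro b b' hb
      exact mul_right_cancel₀ (sub_ne_zero.2 hzu) (add_left_cancel hb)
  have h2 : ∑ b, tripleCount f a b = ∑ x, ∑ u, ∑ z, ∑ b : F,
      if tr (a * (f x + f (x + u) + f z) + b * (x + (x + u) + z)) = 0 then (1 : ℤ) else 0 := by
    simp only [tripleCount]
    rw [Finset.sum_comm]
    refine Finset.sum_congr rfl fun x _ => ?_
    rw [Finset.sum_comm, ← Equiv.sum_comp (Equiv.addLeft x)]
    refine Finset.sum_congr rfl fun u _ => ?_
    rw [Finset.sum_comm]
    rfl
  rw [h2]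
  simp only [h1, Finset.sum_add_distrib, Finset.sum_ite_eq', Finset.mem_univ, if_true,
    Finset.sum_sub_distrib, diffCount, Finset.mul_sum, mul_ite, mul_one, mul_zero]
  simp [hA]
  ring

theorem sum_diffCount [DecidableEq F] (hA : Fintype.card F = 3 * A) {f : F → F}
    (hf : IsPlanar f) : ∑ a, diffCount f a = 9 * A ^ 3 + 6 * A ^ 2 := by
  have : CharP F 3 := charP_of_injective_algebraMap (algebraMap (ZMod 3) F).injective 3
  have h0 := card_filter_add_add_eq_zero hf
  rw [Finset.card_filter, Fintype.sum_prod_type] at h0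
  have h1 : ∀ x u : F, (∑ a : F, if tr (a * (f x + f (x + u) + f (x - u))) = 0
      then (1 : ℤ) else 0) = A + 2 * A * ((if f x + f (x + u) + f (x - u) = 0 then 1 else 0 : ℕ) : ℤ) := by
    intro x u
    rw [show (A + 2 * A * ((if f x + f (x + u) + f (x - u) = 0 then 1 else 0 : ℕ) : ℤ))
      = if f x + f (x + u) + f (x - u) = 0 then (3 * A : ℤ) else A by split_ifs <;> simp; ring]
    exact levelCount_trace_mul hA _
  have h2 : ∑ a, diffCount f a = ∑ x, ∑ u, ∑ a : F,
      if tr (a * (f x + f (x + u) + f (x - u))) = 0 then (1 : ℤ) else 0 := by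
    simp only [diffCount]
    rw [Finset.sum_comm]
    refine Finset.sum_congr rfl fun x _ => ?_
    rw [Finset.sum_comm]
  rw [h2]
  simp only [h1, Finset.sum_add_distrib, ← Finset.mul_sum, ← Nat.cast_sum, h0]
  simp [hA]
  ring

/-- For a fixed second difference c, the number of a with Tr a = Tr(ac) = 0 is exceptional only at c
= 0, 1, -1. These occur q, 2q and 2q times, as 1 = 1² and -1 = i². -/
theorem sum_diffCount_trace_eq_zero [DecidableEq F] (hA : Fintype.card F = 3 * A) {k d : ℕ}
    (hk : Odd k) (hd : 3 ^ k + 1 = 2 * d) (hf : IsPlanar fun x : F => x ^ d) {i : F}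
    (hi : i ^ 2 = -1) :
    (∑ a : F, if tr a = 0 then diffCount (fun x => x ^ d) a else 0) = 3 * A ^ 3 + 10 * A ^ 2 := by
  have : CharP F 3 := charP_of_injective_algebraMap (algebraMap (ZMod 3) F).injective 3
  have hi0 : i ≠ 0 := by rintro rfl; simp at hi
  have h0 := card_filter_add_add_eq_zero hf
  have h1 := card_filter_add_add_eq hk hd hf hi one_ne_zero
  have h2 := card_filter_add_add_eq hk hd hf hi hi0
  rw [Finset.card_filter, Fintype.sum_prod_type] at h0 h1 h2
  simp only [one_pow, hi] at h1 h2
  have hH : ∀ c : F, 3 * (∑ a : F, if tr a = 0 then (if tr (a * c) = 0 then (1 : ℤ) else 0) else 0)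
      = A + 2 * A * ((if c = 0 then 1 else 0 : ℕ) : ℤ) + 2 * A * ((if c = -1 then 1 else 0 : ℕ) : ℤ)
        + 2 * A * ((if c = 1 then 1 else 0 : ℕ) : ℤ) := by
    intro c
    rw [three_mul_sum_trace_trace_mul hA]
    split_ifs <;> push_cast <;> ring
  have h3 : 3 * (∑ a : F, if tr a = 0 then diffCount (fun x => x ^ d) a else 0)
      = ∑ x : F, ∑ u : F, 3 * (∑ a : F, if tr a = 0 then
        (if tr (a * (x ^ d + (x + u) ^ d + (x - u) ^ d)) = 0 then (1 : ℤ) else 0) else 0) := by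
    simp only [← Finset.mul_sum]
    congr 1
    have : ∀ a : F, (if tr a = 0 then diffCount (fun x => x ^ d) a else 0)
        = ∑ x : F, ∑ u : F, if tr a = 0 then
        (if tr (a * (x ^ d + (x + u) ^ d + (x - u) ^ d)) = 0 then (1 : ℤ) else 0) else 0 := by
      intro a
      split_ifs
      · rfl
      · simp
    simp only [this]
    rw [Finset.sum_comm]
    refine Finset.sum_congr rfl fun x _ => ?_
    rw [Finset.sum_comm]
  simp only [hH, Finset.sum_add_distrib, ← Finset.mul_sum, ← Nat.cast_sum, h0, h1, h2] at h3
  simp [hA] at h3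
  linarith

end Trace

/-! ### Generalities on linear codes -/

section LinearCode

variable {K ι : Type*} [Field K] [Fintype ι]

theorem finrank_add_finrank_dualCode (C : Submodule K (ι → K)) :
    Module.finrank K C + Module.finrank K (dualCode C) = Fintype.card ι := by
  classical
  have h : dualCode C = C.dualAnnihilator.comap (dotProductEquiv K ι).toLinearMap := by
    ext v
    simp only [Submodule.mem_comap, Submodule.mem_dualAnnihilator]
    exact Iff.rfl
  rw [h, ← Subspace.finrank_add_finrank_dualAnnihilator_eq C |>.trans
    (Module.finrank_fintype_fun_eq_card K)]
  congr 1
  have := Submodule.comap_equiv_eq_map_symm (dotProductEquiv K ι) C.dualAnnihilator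
  rw [this]
  exact LinearEquiv.finrank_map_eq _ _

variable [DecidableEq K]

theorem hasMinDist_of_hammingNorm {C : Submodule K (ι → K)} {d : ℕ}
    (hle : ∀ w ∈ C, w ≠ 0 → d ≤ hammingNorm w) (hex : ∃ w ∈ C, w ≠ 0 ∧ hammingNorm w = d) :
    HasMinDist C d := by
  constructor
  · obtain ⟨w, hw, hw0, rfl⟩ := hex
    exact ⟨w, hw, 0, C.zero_mem, hw0, hammingDist_zero_right w⟩
  · rintro _ ⟨u, hu, v, hv, huv, rfl⟩
    rw [hammingDist_eq_hammingNorm]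
    have h0 : -u + v ∈ C := C.add_mem (C.neg_mem hu) hv
    refine hle _ h0 fun h => huv ?_
    rw [neg_add_eq_zero] at h
    exact h

theorem weightEnumerator_eq_sum {T : Type*} [Fintype T] (C : Submodule K (ι → K))
    (Φ : T → ι → K) (hΦ : Function.Injective Φ) (hC : ∀ w, w ∈ C ↔ ∃ t, Φ t = w) :
    weightEnumerator C = ∑ t, X ^ hammingNorm (Φ t) := by
  classical
  have hw : ∀ i, weightCount C i = ∑ t, if hammingNorm (Φ t) = i then 1 else 0 := by
    intro i
    rw [← Finset.card_filter, weightCount, ← Finset.card_image_of_injective _ hΦ,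
      ← Set.ncard_coe_finset]
    congr 1
    ext w
    simp only [Set.mem_ofPred_eq, Finset.coe_image, Finset.coe_filter, Finset.mem_univ, true_and,
      Set.mem_image, hC]
    constructor
    · rintro ⟨⟨t, rfl⟩, h⟩
      exact ⟨t, h, rfl⟩
    · rintro ⟨t, h, rfl⟩
      exact ⟨⟨t, rfl⟩, h⟩
  simp only [weightEnumerator, hw, Nat.cast_sum, map_sum, Finset.sum_mul]
  rw [Finset.sum_comm]
  refine Finset.sum_congr rfl fun t _ => ?_
  rw [Finset.sum_eq_single (hammingNorm (Φ t))]
  · simp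
  · intro i _ hi
    simp [Ne.symm hi]
  · intro h
    exact absurd (Finset.mem_range.2 (Nat.lt_succ_of_le hammingNorm_le_card_fintype)) h

theorem hammingNorm_sumElim {α : Type*} [Fintype α] (g : α → K) (c : K) :
    hammingNorm (Sum.elim g fun _ : Unit => c) = hammingNorm g + if c = 0 then 0 else 1 := by
  simp only [hammingNorm, Finset.card_filter, Fintype.sum_sum_type, Sum.elim_inl, Sum.elim_inr,
    Finset.univ_unique, Finset.sum_singleton, ne_eq]
  congr 1
  exact ite_not _ _ _

end LinearCode

/-! ### The dual code -/

section TraceCode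

variable {F : Type*} [Field F] [Fintype F] [Algebra (ZMod 3) F] {f : F → F}

local notation "tr" => Algebra.trace (ZMod 3) F

theorem mem_dualCode_traceCode_iff (v : F ⊕ Unit → ZMod 3) :
    v ∈ dualCode (traceCode 3 f) ↔ (∑ x, v (Sum.inl x) • f x) + v (Sum.inr ()) • (1 : F) = 0 ∧
      (∑ x, v (Sum.inl x) • x) = 0 ∧ ∑ x, v (Sum.inl x) = 0 := by
  have key : ∀ (a b : F) (c : ZMod 3), ∑ i, v i * Sum.elim (fun x => tr (a * f x + b * x) + c)
      (fun _ : Unit => tr a) i = tr (a * ((∑ x, v (Sum.inl x) • f x) + v (Sum.inr ()) • (1 : F)))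
        + tr (b * ∑ x, v (Sum.inl x) • x) + (∑ x, v (Sum.inl x)) * c := by
    intro a b c
    simp only [Fintype.sum_sum_type, Sum.elim_inl, Sum.elim_inr, Finset.univ_unique,
      Finset.sum_singleton, mul_add, Finset.mul_sum, map_add, map_sum, mul_smul_comm, map_smul,
      smul_eq_mul, Finset.sum_add_distrib, Finset.sum_mul, mul_one, PUnit.default_eq_unit]
    ring
  -- Nondegeneracy of the trace form turns orthogonality for all a and b into equations over F.
  have hnd : ∀ c : F, (∀ a, tr (a * c) = 0) → c = 0 := by
    intro c h
    by_contra hc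
    obtain ⟨w, hw⟩ := Algebra.trace_surjective (ZMod 3) F 1
    have := h (w * c⁻¹)
    rw [inv_mul_cancel_right₀ hc, hw] at this
    exact one_ne_zero this
  constructor
  · intro h
    have h' : ∀ (a b : F) (c : ZMod 3), _ = (0 : ZMod 3) :=
      fun a b c => (key a b c).symm.trans (h _ ⟨a, b, c, rfl⟩)
    refine ⟨hnd _ fun a => ?_, hnd _ fun b => ?_, ?_⟩
    · simpa using h' a 0 0
    · simpa using h' 0 b 0
    · simpa using h' 0 0 1
  · rintro ⟨h1, h2, h3⟩ _ ⟨a, b, c, rfl⟩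
    rw [key, h1, h2, h3]
    simp

theorem hasMinDist_dualCode_traceCode (hf : IsPlanar f) (h0 : f 0 = 0) (h1 : f 1 = 1)
    (hm1 : f (-1) = 1) : HasMinDist (dualCode (traceCode 3 f)) 4 := by
  classical
  have : CharP F 3 := charP_of_injective_algebraMap (algebraMap (ZMod 3) F).injective 3
  have h3 := three_eq_zero_of_charP (K := F)
  have hne : (1 : F) ≠ -1 := fun h => one_ne_zero (by linear_combination h3 - h : (1 : F) = 0)
  apply hasMinDist_of_hammingNorm
  · intro v hv hv0
    rw [mem_dualCode_traceCode_iff] at hv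
    obtain ⟨e1, e2, e3⟩ := hv
    by_contra hlt
    set S := Finset.univ.filter fun x : F => v (Sum.inl x) ≠ 0 with hS
    have hnorm : hammingNorm v = S.card + if v (Sum.inr ()) = 0 then 0 else 1 := by
      rw [← hammingNorm, ← hammingNorm_sumElim]
      congr 1
      ext (x | x) <;> rfl
    have hp : ∀ {p : F → Prop}, (∀ x, v (Sum.inl x) = 0 → ¬p x) →
        ∀ x ∈ Finset.univ, p x → v (Sum.inl x) ≠ 0 := fun h x _ hx h0 => h x h0 hx
    rw [← Finset.sum_filter_of_ne (hp fun x hx => not_not.2 (by rw [hx, zero_smul]))] at e1 e2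
    rw [← Finset.sum_filter_of_ne (hp fun x hx => not_not.2 hx)] at e3
    rw [← hS] at e1 e2 e3
    have hmem : ∀ x ∈ S, v (Sum.inl x) ≠ 0 := fun x hx => (Finset.mem_filter.1 hx).2
    have hcases : S.card = 0 ∨ S.card = 1 ∨ S.card = 2 ∨ S.card = 3 := by omega
    rcases hcases with hc | hc | hc | hc
    · rw [Finset.card_eq_zero] at hc
      rw [hc, Finset.sum_empty, zero_add] at e1
      apply hv0
      ext (x | x)
      · by_contra hx
        have : x ∈ S := by rw [hS]; exact Finset.mem_filter.2 ⟨Finset.mem_univ _, hx⟩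
        rw [hc] at this
        exact absurd this (Finset.notMem_empty x)
      · exact (smul_eq_zero.1 e1).resolve_right one_ne_zero
    · obtain ⟨x, hx⟩ := Finset.card_eq_one.1 hc
      rw [hx, Finset.sum_singleton] at e3
      exact hmem x (by simp [hx]) e3
    · obtain ⟨x, y, hxy, hx⟩ := Finset.card_eq_two.1 hc
      rw [hx, Finset.sum_pair hxy] at e2 e3
      have hy : v (Sum.inl y) = -v (Sum.inl x) := by linear_combination e3
      rw [hy, neg_smul, ← sub_eq_add_neg, ← smul_sub] at e2
      rcases smul_eq_zero.1 e2 with h | h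
      · exact hmem x (by simp [hx]) h
      · exact hxy (sub_eq_zero.1 h)
    · obtain ⟨x, y, z, hxy, hxz, hyz, hx⟩ := Finset.card_eq_three.1 hc
      have hinf : v (Sum.inr ()) = 0 := by
        by_contra h
        rw [if_neg h] at hnorm
        omega
      have hx1 : x ∉ ({y, z} : Finset F) := by simp [hxy, hxz]
      rw [hx, Finset.sum_insert hx1, Finset.sum_pair hyz] at e1 e2 e3
      -- Nonzero coefficients in 𝔽₃ with sum zero coincide, so the relation becomes x + y + z = 0
      -- and f(x) + f(y) + f(z) = 0.
      have heq : ∀ p q r : ZMod 3, p ≠ 0 → q ≠ 0 → r ≠ 0 → p + (q + r) = 0 → q = p ∧ r = p := by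
        decide
      have hvx := hmem x (by simp [hx])
      obtain ⟨hy, hz⟩ := heq _ _ _ hvx (hmem y (by simp [hx])) (hmem z (by simp [hx])) e3
      rw [hinf, zero_smul, add_zero, hy, hz, ← smul_add, ← smul_add] at e1
      rw [hy, hz, ← smul_add, ← smul_add] at e2
      have e1 := (smul_eq_zero.1 e1).resolve_left hvx
      have e2 := (smul_eq_zero.1 e2).resolve_left hvx
      refine hf.add_add_ne_zero (sub_ne_zero.2 (Ne.symm hxy)) x ?_
      rw [show x + (y - x) = y by ring, show x - (y - x) = z by linear_combination x * h3 - e2]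
      linear_combination e1
  · let v : F ⊕ Unit → ZMod 3 :=
      Sum.elim (fun x => if x ∈ ({0, 1, -1} : Finset F) then 1 else 0) fun _ => 1
    have h01 : (0 : F) ∉ ({1, -1} : Finset F) := by simp
    refine ⟨v, ?_, ?_, ?_⟩
    · rw [mem_dualCode_traceCode_iff]
      simp only [v, Sum.elim_inl, Sum.elim_inr, ite_smul, one_smul, zero_smul,
        Finset.sum_ite_mem, Finset.univ_inter, Finset.sum_insert h01, Finset.sum_pair hne, h0, h1, hm1]
      refine ⟨by linear_combination h3, by ring, by decide⟩
    · intro h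
      exact one_ne_zero (congrFun h (Sum.inr ()))
    · rw [hammingNorm_sumElim, if_neg one_ne_zero, hammingNorm, Finset.card_filter]
      have : ∀ x : F, (if (if x ∈ ({0, 1, -1} : Finset F) then (1 : ZMod 3) else 0) ≠ 0 then 1 else 0)
          = if x ∈ ({0, 1, -1} : Finset F) then 1 else 0 := by
        intro x
        split_ifs <;> simp_all
      simp only [this, Finset.sum_ite_mem, Finset.univ_inter, Finset.sum_insert h01, Finset.sum_pair hne]
      norm_num

end TraceCode

/-- The codewords of the trace code. -/
noncomputable def traceWord {F : Type*} [Field F] [Algebra (ZMod 3) F]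
    (f : F → F) (a b : F) (c : ZMod 3) : F ⊕ Unit → ZMod 3 :=
  Sum.elim (fun x => Algebra.trace (ZMod 3) F (a * f x + b * x) + c) fun _ => Algebra.trace (ZMod 3) F a

theorem mem_traceCode_iff {F : Type*} [Field F] [Algebra (ZMod 3) F] {f : F → F} (w : F ⊕ Unit → ZMod 3) :
    w ∈ traceCode 3 f ↔ ∃ t : F × F × ZMod 3, traceWord f t.1 t.2.1 t.2.2 = w := by
  constructor
  · rintro ⟨a, b, c, rfl⟩
    exact ⟨(a, b, c), rfl⟩
  · rintro ⟨⟨a, b, c⟩, rfl⟩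
    exact ⟨a, b, c, rfl⟩

/-! ### Weights in terms of level deviations -/

section Weights

variable {F : Type*} [Field F] [Fintype F] [Algebra (ZMod 3) F] {A : ℕ} {f : F → F}

local notation "tr" => Algebra.trace (ZMod 3) F

theorem hammingNorm_traceWord (hA : Fintype.card F = 3 * A) (f : F → F) (a b : F) (c : ZMod 3) :
    (hammingNorm (traceWord f a b c) : ℤ) =
      2 * A - levelDev A f a b (-c) + if tr a = 0 then 0 else 1 := by
  rw [traceWord, hammingNorm_sumElim, hammingNorm, Finset.card_filter]
  push_cast
  congr 1
  have h : ∀ x : F, (if tr (a * f x + b * x) + c ≠ 0 then (1 : ℤ) else 0)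
      = 1 - if traceForm f a b x = -c then 1 else 0 := by
    intro x
    simp only [traceForm, eq_neg_iff_add_eq_zero, ite_not, ne_eq]
    split_ifs <;> rfl
  simp only [h, Finset.sum_sub_distrib, levelDev, levelCount]
  simp [hA]
  ring

theorem levelDev_zero_left (hA : Fintype.card F = 3 * A) {b : F} (hb : b ≠ 0) (t : ZMod 3) :
    levelDev A f 0 b t = 0 := by
  have := levelCount_trace_comp hA (mul_right_injective₀ hb) t
  have h : traceForm f 0 b = fun x => tr (b * x) := by
    funext x
    rw [traceForm, zero_mul, zero_add]
  rw [levelDev, h, this, sub_self]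

theorem levelDev_zero_zero (hA : Fintype.card F = 3 * A) (t : ZMod 3) :
    levelDev A f 0 0 t = if t = 0 then (2 * A : ℤ) else -A := by
  simp only [levelDev, traceForm, levelCount, zero_mul, zero_add, map_zero, eq_comm (a := (0 : ZMod 3))]
  split_ifs
  · simp [hA]; ring
  · simp

/-- The norm form bounds each deviation by 3δ² ≤ 4A. Hence no codeword with a ≠ 0 has weight zero,
which makes the parametrisation injective. -/
theorem levelDev_lt (hA : Fintype.card F = 3 * A) (hA0 : 0 < A) (hf : IsPlanar f) {a : F}
    (ha : a ≠ 0) (b : F) (t : ZMod 3) : levelDev A f a b t < 2 * A := by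
  have h1 := levelDev_sum hA f a b
  have h2 := levelDev_sq hA hf ha b
  have hA1 : (1 : ℤ) ≤ A := by exact_mod_cast hA0
  have h3 : 3 * levelDev A f a b t ^ 2 ≤ 4 * A := by
    have ht : ∀ t : ZMod 3, t = 0 ∨ t = 1 ∨ t = 2 := by decide
    rcases ht t with rfl | rfl | rfl
    · nlinarith [sq_nonneg (levelDev A f a b 0 + 2 * levelDev A f a b 1)]
    · nlinarith [sq_nonneg (2 * levelDev A f a b 0 + levelDev A f a b 1)]
    · rw [show levelDev A f a b 2 = -(levelDev A f a b 0 + levelDev A f a b 1) by linarith]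
      nlinarith [sq_nonneg (levelDev A f a b 0 - levelDev A f a b 1)]
  by_contra h
  nlinarith

theorem hammingNorm_traceWord_pos (hA : Fintype.card F = 3 * A) (hA0 : 0 < A) (hf : IsPlanar f)
    {a b : F} {c : ZMod 3} (h : (a, b, c) ≠ 0) : 0 < hammingNorm (traceWord f a b c) := by
  have hn := hammingNorm_traceWord hA f a b c
  have hA1 : (1 : ℤ) ≤ A := by exact_mod_cast hA0
  by_cases ha : a = 0
  · subst ha
    rw [map_zero, if_pos rfl, add_zero] at hn
    by_cases hb : b = 0
    · subst hb
      have hc : -c ≠ 0 := by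
        intro hc
        rw [neg_eq_zero] at hc
        exact h (by rw [hc]; rfl)
      rw [levelDev_zero_zero hA, if_neg hc] at hn
      omega
    · rw [levelDev_zero_left hA hb] at hn
      omega
  · have := levelDev_lt hA hA0 hf ha b (-c)
    split_ifs at hn <;> omega

theorem traceWord_injective (hA : Fintype.card F = 3 * A) (hA0 : 0 < A) (hf : IsPlanar f) :
    Function.Injective fun t : F × F × ZMod 3 => traceWord f t.1 t.2.1 t.2.2 := by
  rintro ⟨a, b, c⟩ ⟨a', b', c'⟩ h
  by_contra hne
  have h0 : traceWord f (a - a') (b - b') (c - c') = 0 := by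
    have : traceWord f (a - a') (b - b') (c - c') = traceWord f a b c - traceWord f a' b' c' := by
      ext (x | x)
      · simp only [traceWord, Sum.elim_inl, Pi.sub_apply, sub_mul, map_add, map_sub]
        ring
      · simp [traceWord]
    rw [this, sub_eq_zero]
    exact h
  have hpos := hammingNorm_traceWord_pos hA hA0 hf (a := a - a') (b := b - b') (c := c - c')
    (sub_ne_zero.2 hne)
  rw [h0, hammingNorm_zero] at hpos
  exact lt_irrefl _ hpos

theorem finrank_traceCode {m : ℕ} (hF : Fintype.card F = 3 ^ m) (hA : Fintype.card F = 3 * A)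
    (hA0 : 0 < A) (hf : IsPlanar f) :
    Module.finrank (ZMod 3) (traceCode 3 f) = 2 * m + 1 := by
  let Φ : F × F × ZMod 3 → traceCode 3 f := fun t =>
    ⟨traceWord f t.1 t.2.1 t.2.2, (mem_traceCode_iff _).2 ⟨t, rfl⟩⟩
  have hΦ : Function.Bijective Φ := by
    constructor
    · intro s t h
      exact traceWord_injective hA hA0 hf (congrArg Subtype.val h)
    · rintro ⟨w, hw⟩
      obtain ⟨t, rfl⟩ := (mem_traceCode_iff w).1 hw
      exact ⟨t, rfl⟩
  have h1 := Nat.card_eq_of_bijective Φ hΦ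
  have h2 := Module.natCard_eq_pow_finrank (K := ZMod 3) (V := traceCode 3 f)
  rw [← h1, Nat.card_prod, Nat.card_prod, Nat.card_eq_fintype_card, Nat.card_eq_fintype_card,
    hF, ZMod.card] at h2
  refine (Nat.pow_right_injective (le_refl 2 |>.trans (by norm_num : 2 ≤ 3)) ?_).symm
  change 3 ^ (2 * m + 1) = 3 ^ _
  rw [← h2]
  ring

/-- The contribution of a pair `(a, b)` to the weight enumerator. -/
noncomputable def pairEnumerator (f : F → F) (a b : F) : ℚ[X] :=
  ∑ c, X ^ hammingNorm (traceWord f a b c)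

theorem pairEnumerator_eq (hA : Fintype.card F = 3 * A) {a b : F} {i j l n : ℕ}
    (h0 : (i : ℤ) = 2 * A - levelDev A f a b 0 + n) (h1 : (j : ℤ) = 2 * A - levelDev A f a b 1 + n)
    (h2 : (l : ℤ) = 2 * A - levelDev A f a b 2 + n) (hn : n = if tr a = 0 then 0 else 1) :
    pairEnumerator f a b = X ^ i + X ^ j + X ^ l := by
  have e : ∀ c, (hammingNorm (traceWord f a b c) : ℤ) = 2 * A - levelDev A f a b (-c) + n := by
    intro c
    rw [hammingNorm_traceWord hA, hn]
    split_ifs <;> rfl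
  have e0 := e 0
  have e1 := e 1
  have e2 := e 2
  rw [show -(0 : ZMod 3) = 0 by decide, ← h0, Nat.cast_inj] at e0
  rw [show -(1 : ZMod 3) = 2 by decide, ← h2, Nat.cast_inj] at e1
  rw [show -(2 : ZMod 3) = 1 by decide, ← h1, Nat.cast_inj] at e2
  rw [pairEnumerator, ZMod.sum_univ_three, e0, e1, e2]
  ring

theorem pairEnumerator_zero_left (hA : Fintype.card F = 3 * A) {b : F} (hb : b ≠ 0) :
    pairEnumerator f 0 b = 3 * X ^ (2 * A) := by
  rw [pairEnumerator_eq hA (i := 2 * A) (j := 2 * A) (l := 2 * A) (n := 0)]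
  · ring
  all_goals simp [levelDev_zero_left hA hb]

theorem pairEnumerator_zero_zero (hA : Fintype.card F = 3 * A) :
    pairEnumerator f 0 0 = 1 + 2 * X ^ (3 * A) := by
  rw [pairEnumerator_eq hA (i := 0) (j := 3 * A) (l := 3 * A) (n := 0)]
  · ring
  · simp [levelDev_zero_zero hA]
  · rw [levelDev_zero_zero hA, if_neg (by decide)]; push_cast; ring
  · rw [levelDev_zero_zero hA, if_neg (by decide)]; push_cast; ring
  · simp

theorem card_filter_trace_eq_zero [DecidableEq F] (hA : Fintype.card F = 3 * A) :
    (Finset.univ.filter fun a : F => tr a = 0).card = A := by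
  have := levelCount_trace hA 0
  rw [levelCount] at this
  rw [Finset.card_filter]
  exact_mod_cast this

theorem card_filter_ne_zero_trace_eq_zero [DecidableEq F] (hA : Fintype.card F = 3 * A) :
    (Finset.univ.filter fun a : F => a ≠ 0 ∧ tr a = 0).card = A - 1 := by
  rw [← card_filter_trace_eq_zero hA, ← Finset.card_erase_of_mem (a := (0 : F)) (by simp)]
  congr 1
  ext a
  simp

theorem card_filter_trace_ne_zero [DecidableEq F] (hA : Fintype.card F = 3 * A) :
    (Finset.univ.filter fun a : F => tr a ≠ 0).card = 2 * A := by
  have h1 := Finset.card_filter_add_card_filter_not (s := Finset.univ) (fun a : F => tr a = 0)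
  rw [card_filter_trace_eq_zero hA, Finset.card_univ, hA] at h1
  simp only [ne_eq]
  omega

theorem sum_eq_add_sum_trace [DecidableEq F] {M : Type*} [AddCommMonoid M] (g : F → M) :
    ∑ a, g a = g 0 + (∑ a with a ≠ 0 ∧ tr a = 0, g a) + ∑ a with tr a ≠ 0, g a := by
  rw [← Finset.sum_filter_add_sum_filter_not Finset.univ (fun a : F => tr a = 0) g]
  congr 1
  rw [← Finset.add_sum_erase _ g (a := 0) (by simp)]
  congr 2
  ext a
  simp

theorem weightEnumerator_traceCode [DecidableEq F] (hA : Fintype.card F = 3 * A) (hA0 : 0 < A)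
    (hf : IsPlanar f) :
    weightEnumerator (traceCode 3 f) =
      1 + 2 * X ^ (3 * A) + C (3 * (3 * A - 1) : ℚ) * X ^ (2 * A)
        + (∑ a with a ≠ 0 ∧ tr a = 0, ∑ b, pairEnumerator f a b)
        + ∑ a with tr a ≠ 0, ∑ b, pairEnumerator f a b := by
  rw [weightEnumerator_eq_sum _ _ (traceWord_injective hA hA0 hf) mem_traceCode_iff,
    Fintype.sum_prod_type]
  simp only [Fintype.sum_prod_type]
  rw [sum_eq_add_sum_trace]
  change (∑ b, pairEnumerator f 0 b) + (∑ a with a ≠ 0 ∧ tr a = 0, ∑ b, pairEnumerator f a b)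
    + (∑ a with tr a ≠ 0, ∑ b, pairEnumerator f a b) = _
  congr 2
  rw [← Finset.add_sum_erase _ _ (Finset.mem_univ (0 : F)), pairEnumerator_zero_zero hA,
    Finset.sum_congr rfl fun b hb => pairEnumerator_zero_left hA (Finset.ne_of_mem_erase hb)]
  rw [Finset.sum_const, Finset.card_erase_of_mem (Finset.mem_univ _), Finset.card_univ, hA,
    nsmul_eq_mul, Nat.cast_sub (by omega)]
  simp only [map_sub, map_mul, map_one, map_natCast, map_ofNat]
  push_cast
  ring

end Weights

/-! ### Sign statistics and weight patterns -/

section Distribution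

variable {F : Type*} [Field F] [Fintype F] [Algebra (ZMod 3) F] {A : ℕ} {f : F → F}

local notation "tr" => Algebra.trace (ZMod 3) F

/-- The product of the three deviations, which carries the sign of the exponential sum. -/
noncomputable def levelProd (A : ℕ) (f : F → F) (a b : F) : ℤ :=
  levelDev A f a b 0 * levelDev A f a b 1 * levelDev A f a b 2

theorem nine_mul_sum_levelProd (hA : Fintype.card F = 3 * A) (f : F → F) (a : F) :
    9 * ∑ b, levelProd A f a b = 3 * A * diffCount f a - 9 * A ^ 3 := by
  have h := sum_tripleCount hA f a
  simp only [tripleCount_eq hA, Finset.sum_add_distrib, ← Finset.mul_sum] at h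
  simp only [Finset.sum_const, Finset.card_univ, hA, nsmul_eq_mul] at h
  push_cast at h
  simp only [levelProd]
  linarith

theorem diffCount_zero (hA : Fintype.card F = 3 * A) (f : F → F) :
    diffCount f 0 = 9 * A ^ 2 := by
  simp [diffCount, hA]
  ring

theorem nine_mul_sum_sum_levelProd (hA : Fintype.card F = 3 * A) (f : F → F) (S : Finset F) :
    9 * ∑ a ∈ S, ∑ b, levelProd A f a b
      = 3 * A * (∑ a ∈ S, diffCount f a) - 9 * A ^ 3 * S.card := by
  rw [Finset.mul_sum]
  simp only [nine_mul_sum_levelProd hA, Finset.sum_sub_distrib, ← Finset.mul_sum,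
    Finset.sum_const, nsmul_eq_mul]
  ring

theorem sum_levelProd_trace_eq_zero [DecidableEq F] (hA : Fintype.card F = 3 * A) (hA0 : 0 < A)
    {k d : ℕ} (hk : Odd k) (hd : 3 ^ k + 1 = 2 * d) (hf : IsPlanar fun x : F => x ^ d) {i : F}
    (hi : i ^ 2 = -1) :
    9 * ∑ a with a ≠ 0 ∧ tr a = 0, ∑ b, levelProd A (fun x => x ^ d) a b = 12 * A ^ 3 := by
  have h := sum_diffCount_trace_eq_zero hA hk hd hf hi
  rw [← Finset.sum_filter, ← Finset.add_sum_erase _ _ (a := (0 : F)) (by simp),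
    diffCount_zero hA] at h
  have e : (Finset.univ.filter fun a : F => tr a = 0).erase 0
      = Finset.univ.filter fun a : F => a ≠ 0 ∧ tr a = 0 := by
    ext a
    simp
  rw [e] at h
  rw [nine_mul_sum_sum_levelProd hA, card_filter_ne_zero_trace_eq_zero hA, Nat.cast_sub hA0]
  push_cast
  linear_combination 3 * (A : ℤ) * h

theorem sum_levelProd_trace_ne_zero [DecidableEq F] (hA : Fintype.card F = 3 * A)
    {k d : ℕ} (hk : Odd k) (hd : 3 ^ k + 1 = 2 * d) (hf : IsPlanar fun x : F => x ^ d) {i : F}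
    (hi : i ^ 2 = -1) :
    9 * ∑ a with tr a ≠ 0, ∑ b, levelProd A (fun x => x ^ d) a b = -12 * A ^ 3 := by
  have h := sum_diffCount_trace_eq_zero hA hk hd hf hi
  have h' := sum_diffCount hA hf
  rw [← Finset.sum_filter_add_sum_filter_not Finset.univ (fun a : F => tr a = 0),
    Finset.sum_filter, h] at h'
  rw [nine_mul_sum_sum_levelProd hA, card_filter_trace_ne_zero hA]
  push_cast
  linear_combination 3 * (A : ℤ) * h'

theorem levelDev_of_odd {r l : ℕ} (hr : r = 3 ^ l) (hAr : A = 3 ^ (2 * l))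
    (hA : Fintype.card F = 3 * A) (hf : IsPlanar f) {a : F} (ha : a ≠ 0) (b : F) :
    (levelDev A f a b 0 = 0 ∧ levelDev A f a b 1 = r ∧ levelDev A f a b 2 = -r) ∨
    (levelDev A f a b 0 = 0 ∧ levelDev A f a b 1 = -r ∧ levelDev A f a b 2 = r) ∨
    (levelDev A f a b 0 = r ∧ levelDev A f a b 1 = 0 ∧ levelDev A f a b 2 = -r) ∨
    (levelDev A f a b 0 = -r ∧ levelDev A f a b 1 = 0 ∧ levelDev A f a b 2 = r) ∨
    (levelDev A f a b 0 = r ∧ levelDev A f a b 1 = -r ∧ levelDev A f a b 2 = 0) ∨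
    (levelDev A f a b 0 = -r ∧ levelDev A f a b 1 = r ∧ levelDev A f a b 2 = 0) := by
  have h1 := levelDev_sum hA f a b
  have h2 := levelDev_sq hA hf ha b
  have h3 := (int_sum_sq_three_pow l _ _).1 (h2.trans (by rw [hAr]; push_cast; rfl))
  rw [show (3 : ℤ) ^ l = r by rw [hr]; push_cast; rfl] at h3
  refine h3.imp ?_ (Or.imp ?_ (Or.imp ?_ (Or.imp ?_ (Or.imp ?_ ?_)))) <;>
    (rintro ⟨h, h'⟩; exact ⟨h, h', by linarith⟩)

theorem pairEnumerator_of_odd {r l n : ℕ} (hr : r = 3 ^ l) (hAr : A = 3 ^ (2 * l))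
    (hA : Fintype.card F = 3 * A) (hf : IsPlanar f) {a : F} (ha : a ≠ 0) (b : F)
    (hn : n = if tr a = 0 then 0 else 1) :
    pairEnumerator f a b = X ^ (2 * A + n) + X ^ (2 * A + r + n) + X ^ (2 * A - r + n) := by
  have hrA : r ≤ A := by
    rw [hr, hAr]; exact Nat.pow_le_pow_right (by norm_num) (by omega)
  rcases levelDev_of_odd hr hAr hA hf ha b with ⟨h0, h1, h2⟩ | ⟨h0, h1, h2⟩ | ⟨h0, h1, h2⟩ |
    ⟨h0, h1, h2⟩ | ⟨h0, h1, h2⟩ | ⟨h0, h1, h2⟩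
  · rw [pairEnumerator_eq hA (i := 2 * A + n) (j := 2 * A - r + n) (l := 2 * A + r + n)
      (by omega) (by omega) (by omega) hn]
    ring
  · rw [pairEnumerator_eq hA (i := 2 * A + n) (j := 2 * A + r + n) (l := 2 * A - r + n)
      (by omega) (by omega) (by omega) hn]
  · rw [pairEnumerator_eq hA (i := 2 * A - r + n) (j := 2 * A + n) (l := 2 * A + r + n)
      (by omega) (by omega) (by omega) hn]
    ring
  · rw [pairEnumerator_eq hA (i := 2 * A + r + n) (j := 2 * A + n) (l := 2 * A - r + n)
      (by omega) (by omega) (by omega) hn]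
    ring
  · rw [pairEnumerator_eq hA (i := 2 * A - r + n) (j := 2 * A + r + n) (l := 2 * A + n)
      (by omega) (by omega) (by omega) hn]
    ring
  · rw [pairEnumerator_eq hA (i := 2 * A + r + n) (j := 2 * A - r + n) (l := 2 * A + n)
      (by omega) (by omega) (by omega) hn]
    ring

theorem levelDev_of_even {s l : ℕ} (hs : s = 3 ^ l) (hAs : A = 3 ^ (2 * l + 1))
    (hA : Fintype.card F = 3 * A) (hf : IsPlanar f) {a : F} (ha : a ≠ 0) (b : F) :
    (levelDev A f a b 0 = s ∧ levelDev A f a b 1 = s ∧ levelDev A f a b 2 = -2 * s) ∨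
    (levelDev A f a b 0 = -s ∧ levelDev A f a b 1 = -s ∧ levelDev A f a b 2 = 2 * s) ∨
    (levelDev A f a b 0 = -2 * s ∧ levelDev A f a b 1 = s ∧ levelDev A f a b 2 = s) ∨
    (levelDev A f a b 0 = 2 * s ∧ levelDev A f a b 1 = -s ∧ levelDev A f a b 2 = -s) ∨
    (levelDev A f a b 0 = s ∧ levelDev A f a b 1 = -2 * s ∧ levelDev A f a b 2 = s) ∨
    (levelDev A f a b 0 = -s ∧ levelDev A f a b 1 = 2 * s ∧ levelDev A f a b 2 = -s) := by
  have h1 := levelDev_sum hA f a b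
  have h2 := levelDev_sq hA hf ha b
  have h3 := (int_sum_sq_three_pow l _ _).2 (h2.trans (by rw [hAs]; push_cast; rfl))
  rw [show (3 : ℤ) ^ l = s by rw [hs]; push_cast; rfl] at h3
  refine h3.imp ?_ (Or.imp ?_ (Or.imp ?_ (Or.imp ?_ (Or.imp ?_ ?_)))) <;>
    (rintro ⟨h, h'⟩; exact ⟨h, h', by linarith⟩)

theorem levelProd_and_pairEnumerator_of_even {s l n : ℕ} (hs : s = 3 ^ l)
    (hAs : A = 3 ^ (2 * l + 1)) (hA : Fintype.card F = 3 * A) (hf : IsPlanar f) {a : F}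
    (ha : a ≠ 0) (b : F) (hn : n = if tr a = 0 then 0 else 1) :
    (levelProd A f a b = 2 * s ^ 3 ∧
      pairEnumerator f a b = X ^ (2 * (A - s) + n) + 2 * X ^ (2 * A + s + n)) ∨
    (levelProd A f a b = -2 * s ^ 3 ∧
      pairEnumerator f a b = X ^ (2 * (A + s) + n) + 2 * X ^ (2 * A - s + n)) := by
  have hsA : s ≤ A := by
    rw [hs, hAs]; exact Nat.pow_le_pow_right (by norm_num) (by omega)
  rcases levelDev_of_even hs hAs hA hf ha b with ⟨h0, h1, h2⟩ | ⟨h0, h1, h2⟩ | ⟨h0, h1, h2⟩ |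
    ⟨h0, h1, h2⟩ | ⟨h0, h1, h2⟩ | ⟨h0, h1, h2⟩
  · refine Or.inr ⟨by rw [levelProd, h0, h1, h2]; ring, ?_⟩
    rw [pairEnumerator_eq hA (i := 2 * A - s + n) (j := 2 * A - s + n) (l := 2 * (A + s) + n)
      (by omega) (by omega) (by omega) hn]
    ring
  · refine Or.inl ⟨by rw [levelProd, h0, h1, h2]; ring, ?_⟩
    rw [pairEnumerator_eq hA (i := 2 * A + s + n) (j := 2 * A + s + n) (l := 2 * (A - s) + n)
      (by omega) (by omega) (by omega) hn]
    ring
  · refine Or.inr ⟨by rw [levelProd, h0, h1, h2]; ring, ?_⟩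
    rw [pairEnumerator_eq hA (i := 2 * (A + s) + n) (j := 2 * A - s + n) (l := 2 * A - s + n)
      (by omega) (by omega) (by omega) hn]
    ring
  · refine Or.inl ⟨by rw [levelProd, h0, h1, h2]; ring, ?_⟩
    rw [pairEnumerator_eq hA (i := 2 * (A - s) + n) (j := 2 * A + s + n) (l := 2 * A + s + n)
      (by omega) (by omega) (by omega) hn]
    ring
  · refine Or.inr ⟨by rw [levelProd, h0, h1, h2]; ring, ?_⟩
    rw [pairEnumerator_eq hA (i := 2 * A - s + n) (j := 2 * (A + s) + n) (l := 2 * A - s + n)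
      (by omega) (by omega) (by omega) hn]
    ring
  · refine Or.inl ⟨by rw [levelProd, h0, h1, h2]; ring, ?_⟩
    rw [pairEnumerator_eq hA (i := 2 * A + s + n) (j := 2 * (A - s) + n) (l := 2 * A + s + n)
      (by omega) (by omega) (by omega) hn]
    ring

/-- As `levelProd` is ±2s³, the coefficients 1/2 ± `levelProd`/(4s³) are indicators of the two
patterns. The enumerator is thus linear in `levelProd`, and its sums need only the first moment. -/
theorem pairEnumerator_of_even {s l n : ℕ} (hs : s = 3 ^ l)
    (hAs : A = 3 ^ (2 * l + 1)) (hA : Fintype.card F = 3 * A) (hf : IsPlanar f) {a : F}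
    (ha : a ≠ 0) (b : F) (hn : n = if tr a = 0 then 0 else 1) :
    pairEnumerator f a b =
      C (1 / 2 + (levelProd A f a b : ℚ) / (4 * s ^ 3)) *
        (X ^ (2 * (A - s) + n) + 2 * X ^ (2 * A + s + n)) +
      C (1 / 2 - (levelProd A f a b : ℚ) / (4 * s ^ 3)) *
        (X ^ (2 * (A + s) + n) + 2 * X ^ (2 * A - s + n)) := by
  have hs0 : (s : ℚ) ≠ 0 := by rw [hs]; positivity
  rcases levelProd_and_pairEnumerator_of_even hs hAs hA hf ha b hn with ⟨h, h'⟩ | ⟨h, h'⟩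
  · rw [h', h]
    push_cast
    rw [show (1 / 2 + 2 * (s : ℚ) ^ 3 / (4 * s ^ 3)) = 1 by field_simp; norm_num,
      show (1 / 2 - 2 * (s : ℚ) ^ 3 / (4 * s ^ 3)) = 0 by field_simp; norm_num]
    simp
  · rw [h', h]
    push_cast
    rw [show (1 / 2 + -2 * (s : ℚ) ^ 3 / (4 * s ^ 3)) = 0 by field_simp; norm_num,
      show (1 / 2 - -2 * (s : ℚ) ^ 3 / (4 * s ^ 3)) = 1 by field_simp; norm_num]
    simp

theorem sum_pairEnumerator_of_even {s l n : ℕ} (hs : s = 3 ^ l) (hAs : A = 3 ^ (2 * l + 1))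
    (hA : Fintype.card F = 3 * A) (hf : IsPlanar f) (S : Finset F)
    (hS : ∀ a ∈ S, a ≠ 0 ∧ n = if tr a = 0 then 0 else 1) {E u v : ℚ}
    (hE : ((∑ a ∈ S, ∑ b, levelProd A f a b : ℤ) : ℚ) = 4 * s ^ 3 * E)
    (hu : u = S.card * (3 * A) / 2 + E) (hv : v = S.card * (3 * A) / 2 - E) :
    ∑ a ∈ S, ∑ b, pairEnumerator f a b =
      C u * (X ^ (2 * (A - s) + n) + 2 * X ^ (2 * A + s + n)) +
      C v * (X ^ (2 * (A + s) + n) + 2 * X ^ (2 * A - s + n)) := by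
  have hs0 : (s : ℚ) ≠ 0 := by rw [hs]; positivity
  rw [Finset.sum_congr rfl fun a ha => Finset.sum_congr rfl fun b _ =>
    pairEnumerator_of_even hs hAs hA hf (hS a ha).1 b (hS a ha).2]
  simp only [Finset.sum_add_distrib, ← Finset.sum_mul, ← map_sum, Finset.sum_sub_distrib,
    ← Finset.sum_div]
  have hE' : (∑ a ∈ S, ∑ b, (levelProd A f a b : ℚ)) / (4 * s ^ 3) = E := by
    push_cast at hE
    rw [hE, mul_div_cancel_left₀ _ (by positivity)]
  rw [hE', hu, hv]
  simp only [Finset.sum_const, Finset.card_univ, hA, nsmul_eq_mul, Nat.cast_mul, Nat.cast_ofNat]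
  congr 3 <;> ring

end Distribution

/-! ### Minimum distance and weight enumerator of the code -/

section Distribution

variable {F : Type*} [Field F] [Fintype F] [Algebra (ZMod 3) F] {A : ℕ} {f : F → F}

local notation "tr" => Algebra.trace (ZMod 3) F

theorem hasMinDist_traceCode (hA : Fintype.card F = 3 * A) (hA0 : 0 < A) (hf : IsPlanar f)
    {d : ℕ} (hd : d ≤ 2 * A)
    (hle : ∀ a ≠ 0, ∀ b c, d ≤ hammingNorm (traceWord f a b c))
    (hex : ∃ a b c, (a, b, c) ≠ 0 ∧ hammingNorm (traceWord f a b c) = d) :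
    HasMinDist (traceCode 3 f) d := by
  apply hasMinDist_of_hammingNorm
  · intro w hw hw0
    obtain ⟨⟨a, b, c⟩, rfl⟩ := (mem_traceCode_iff w).1 hw
    by_cases ha : a = 0
    · subst ha
      have hn := hammingNorm_traceWord hA f 0 b c
      rw [map_zero, if_pos rfl, add_zero] at hn
      have hpos := hammingNorm_pos_iff.2 hw0
      change d ≤ hammingNorm (traceWord f 0 b c)
      change 0 < hammingNorm (traceWord f 0 b c) at hpos
      by_cases hb : b = 0
      · subst hb
        rw [levelDev_zero_zero hA] at hn
        split_ifs at hn <;> omega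
      · rw [levelDev_zero_left hA hb] at hn
        omega
    · exact hle a ha b c
  · obtain ⟨a, b, c, h, hn⟩ := hex
    refine ⟨_, (mem_traceCode_iff _).2 ⟨(a, b, c), rfl⟩, ?_, hn⟩
    exact hammingNorm_pos_iff.1 (hammingNorm_traceWord_pos hA hA0 hf h)

theorem hasMinDist_traceCode_of_odd {r l : ℕ} (hr : r = 3 ^ l) (hAr : A = 3 ^ (2 * l))
    (hA : Fintype.card F = 3 * A) (hA1 : 1 < A) (hf : IsPlanar f) :
    HasMinDist (traceCode 3 f) (2 * A - r) := by
  classical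
  have hrA : r ≤ A := by
    rw [hr, hAr]; exact Nat.pow_le_pow_right (by norm_num) (by omega)
  have ht : ∀ t : ZMod 3, t = 0 ∨ t = 1 ∨ t = 2 := by decide
  refine hasMinDist_traceCode hA (by omega) hf (by omega) ?_ ?_
  · intro a ha b c
    have hn := hammingNorm_traceWord hA f a b c
    have hdev := levelDev_of_odd hr hAr hA hf ha b
    have hle : levelDev A f a b (-c) ≤ r := by
      rcases ht (-c) with h | h | h <;> rw [h] <;> omega
    split_ifs at hn <;> omega
  -- A > 1 supplies a nonzero a of trace zero, so the last coordinate adds nothing to the weight.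
  · obtain ⟨a, ha⟩ : (Finset.univ.filter fun a : F => a ≠ 0 ∧ tr a = 0).Nonempty := by
      rw [← Finset.card_pos, card_filter_ne_zero_trace_eq_zero hA]
      omega
    obtain ⟨-, ha0, hta⟩ := Finset.mem_filter.1 ha
    have hdev := levelDev_of_odd hr hAr hA hf ha0 0
    obtain ⟨t, htr⟩ : ∃ t, levelDev A f a 0 t = r := by
      by_contra! h
      have h0 := h 0
      have h1 := h 1
      have h2 := h 2
      omega
    refine ⟨a, 0, -t, fun h => ha0 (congrArg Prod.fst h), ?_⟩
    have hn := hammingNorm_traceWord hA f a 0 (-t)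
    rw [neg_neg, htr, if_pos hta] at hn
    omega

theorem hasMinDist_traceCode_of_card_eq_three (hA : Fintype.card F = 3 * 1) (hf : IsPlanar f) :
    HasMinDist (traceCode 3 f) 2 := by
  classical
  have ht : ∀ t : ZMod 3, t = 0 ∨ t = 1 ∨ t = 2 := by decide
  refine hasMinDist_traceCode hA one_pos hf le_rfl ?_ ?_
  · intro a ha b c
    have hn := hammingNorm_traceWord hA f a b c
    have hdev := levelDev_of_odd (A := 1) (r := 1) (l := 0) rfl rfl hA hf ha b
    -- Over three elements only a = 0 has trace zero, so the last coordinate raises the minimum for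
    -- a ≠ 0 from 1 to 2.
    have hta : tr a ≠ 0 := by
      intro h
      have h0 := card_filter_ne_zero_trace_eq_zero hA
      rw [Nat.sub_self, Finset.card_eq_zero] at h0
      have : a ∈ Finset.univ.filter fun a : F => a ≠ 0 ∧ tr a = 0 :=
        Finset.mem_filter.2 ⟨Finset.mem_univ _, ha, h⟩
      rw [h0] at this
      exact Finset.notMem_empty a this
    have hle : levelDev 1 f a b (-c) ≤ 1 := by
      rcases ht (-c) with h | h | h <;> rw [h] <;> omega
    rw [if_neg hta] at hn
    omega
  · refine ⟨0, 1, 0, fun h => one_ne_zero (congrArg (fun t => t.2.1) h), ?_⟩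
    have hn := hammingNorm_traceWord hA f 0 1 0
    rw [levelDev_zero_left hA one_ne_zero, map_zero, if_pos rfl] at hn
    omega

theorem hasMinDist_traceCode_of_even {s l : ℕ} (hs : s = 3 ^ l) (hAs : A = 3 ^ (2 * l + 1))
    (hA : Fintype.card F = 3 * A) (hf : IsPlanar f)
    (hpos : ∃ a b, a ≠ 0 ∧ tr a = 0 ∧ 0 < levelProd A f a b) :
    HasMinDist (traceCode 3 f) (2 * A - 2 * s) := by
  have hsA : s ≤ A := by
    rw [hs, hAs]; exact Nat.pow_le_pow_right (by norm_num) (by omega)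
  have hs0 : 0 < s := by rw [hs]; positivity
  have ht : ∀ t : ZMod 3, t = 0 ∨ t = 1 ∨ t = 2 := by decide
  refine hasMinDist_traceCode hA (by omega) hf (by omega) ?_ ?_
  · intro a ha b c
    have hn := hammingNorm_traceWord hA f a b c
    have hdev := levelDev_of_even hs hAs hA hf ha b
    have hle : levelDev A f a b (-c) ≤ 2 * s := by
      rcases ht (-c) with h | h | h <;> rw [h] <;> omega
    split_ifs at hn <;> omega
  · obtain ⟨a, b, ha0, hta, hp⟩ := hpos
    have hneg : ∀ x : ℤ, x = -2 * s ^ 3 → ¬ 0 < x := by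
      rintro x rfl
      have : (0 : ℤ) ≤ s ^ 3 := by positivity
      linarith
    have hdev := levelDev_of_even hs hAs hA hf ha0 b
    obtain ⟨t, htr⟩ : ∃ t, levelDev A f a b t = 2 * s := by
      rcases hdev with ⟨h0, h1, h2⟩ | h | ⟨h0, h1, h2⟩ | h | ⟨h0, h1, h2⟩ | h
      · exact absurd hp (hneg _ (by rw [levelProd, h0, h1, h2]; ring))
      · exact ⟨2, h.2.2⟩
      · exact absurd hp (hneg _ (by rw [levelProd, h0, h1, h2]; ring))
      · exact ⟨0, h.1⟩
      · exact absurd hp (hneg _ (by rw [levelProd, h0, h1, h2]; ring))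
      · exact ⟨1, h.2.1⟩
    refine ⟨a, b, -t, fun h => ha0 (congrArg Prod.fst h), ?_⟩
    have hn := hammingNorm_traceWord hA f a b (-t)
    rw [neg_neg, htr, if_pos hta] at hn
    omega

theorem weightEnumerator_traceCode_of_odd {r l : ℕ} (hr : r = 3 ^ l) (hAr : A = 3 ^ (2 * l))
    (hA : Fintype.card F = 3 * A) (hA0 : 0 < A) (hf : IsPlanar f) :
    weightEnumerator (traceCode 3 f) =
      1 + C 2 * X ^ (3 * A)
      + C (3 * (A : ℚ) ^ 2 + 2 * (3 * A) - 3) * X ^ (2 * A)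
      + C ((3 * (A : ℚ) - A) * (3 * A)) * X ^ (2 * A + 1)
      + C (((A : ℚ) - 1) * (3 * A)) * X ^ (2 * A + r)
      + C (((A : ℚ) - 1) * (3 * A)) * X ^ (2 * A - r)
      + C ((3 * (A : ℚ) - A) * (3 * A)) * X ^ (2 * A + r + 1)
      + C ((3 * (A : ℚ) - A) * (3 * A)) * X ^ (2 * A - r + 1) := by
  classical
  rw [weightEnumerator_traceCode hA hA0 hf,
    Finset.sum_congr rfl fun a ha => Finset.sum_congr rfl fun b _ =>
      pairEnumerator_of_odd hr hAr hA hf (Finset.mem_filter.1 ha).2.1 b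
        (if_pos (Finset.mem_filter.1 ha).2.2).symm,
    Finset.sum_congr (s₁ := Finset.univ.filter fun a : F => tr a ≠ 0) rfl fun a ha =>
      Finset.sum_congr rfl fun b _ =>
      pairEnumerator_of_odd hr hAr hA hf
        (fun h => (Finset.mem_filter.1 ha).2 (by rw [h, map_zero])) b
        (if_neg (Finset.mem_filter.1 ha).2).symm]
  simp only [Finset.sum_const, Finset.card_univ, hA, card_filter_ne_zero_trace_eq_zero hA,
    card_filter_trace_ne_zero hA, nsmul_eq_mul, Nat.cast_sub hA0, map_add, map_sub, map_mul,
    map_pow, map_ofNat, map_one, map_natCast, Nat.cast_mul, Nat.cast_ofNat, Nat.cast_one, add_zero]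
  ring

theorem weightEnumerator_traceCode_of_even [DecidableEq F] {s l : ℕ} (hs : s = 3 ^ l)
    (hAs : A = 3 ^ (2 * l + 1)) (hA : Fintype.card F = 3 * A) (hA0 : 0 < A) (hf : IsPlanar f)
    (h0 : 9 * ∑ a with a ≠ 0 ∧ tr a = 0, ∑ b, levelProd A f a b = 12 * A ^ 3)
    (h1 : 9 * ∑ a with tr a ≠ 0, ∑ b, levelProd A f a b = -12 * A ^ 3) :
    weightEnumerator (traceCode 3 f) =
      1 + C 2 * X ^ (3 * A)
      + C (3 * (3 * (A : ℚ) - 1)) * X ^ (2 * A)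
      + C ((27 * (s : ℚ) ^ 4 - 3 * A) / 2 - 9 * s ^ 3) * X ^ (2 * (A + s))
      + C ((27 * (s : ℚ) ^ 4 - 3 * A) / 2 + 9 * s ^ 3) * X ^ (2 * (A - s))
      + C (27 * (s : ℚ) ^ 4 + 9 * s ^ 3) * X ^ (2 * (A + s) + 1)
      + C (27 * (s : ℚ) ^ 4 - 9 * s ^ 3) * X ^ (2 * (A - s) + 1)
      + C (27 * (s : ℚ) ^ 4 - 3 * A + 2 * (9 * s ^ 3)) * X ^ (2 * A + s)
      + C (27 * (s : ℚ) ^ 4 - 3 * A - 2 * (9 * s ^ 3)) * X ^ (2 * A - s)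
      + C (2 * (27 * (s : ℚ) ^ 4 - 9 * s ^ 3)) * X ^ (2 * A + s + 1)
      + C (2 * (27 * (s : ℚ) ^ 4 + 9 * s ^ 3)) * X ^ (2 * A - s + 1) := by
  have hAq : (A : ℚ) = 3 * s ^ 2 := by rw [hs, hAs]; push_cast; ring
  have h0q := congrArg (Int.cast : ℤ → ℚ) h0
  have h1q := congrArg (Int.cast : ℤ → ℚ) h1
  rw [Int.cast_mul] at h0q h1q
  push_cast [hAq] at h0q h1q
  -- E is the sum of `levelProd` over 4s³: with A = 3s², (12A³/9)/(4s³) = 9s³, and the opposite sign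
  -- when Tr a ≠ 0.
  have e0 := sum_pairEnumerator_of_even (n := 0) hs hAs hA hf
    (Finset.univ.filter fun a : F => a ≠ 0 ∧ tr a = 0)
    (fun a ha => ⟨(Finset.mem_filter.1 ha).2.1, (if_pos (Finset.mem_filter.1 ha).2.2).symm⟩)
    (E := 9 * s ^ 3) (u := (27 * (s : ℚ) ^ 4 - 3 * A) / 2 + 9 * s ^ 3)
    (v := (27 * (s : ℚ) ^ 4 - 3 * A) / 2 - 9 * s ^ 3) (by push_cast; linear_combination h0q / 9)
    (by rw [card_filter_ne_zero_trace_eq_zero hA, Nat.cast_sub hA0, hAq]; push_cast; ring)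
    (by rw [card_filter_ne_zero_trace_eq_zero hA, Nat.cast_sub hA0, hAq]; push_cast; ring)
  have e1 := sum_pairEnumerator_of_even (n := 1) hs hAs hA hf
    (Finset.univ.filter fun a : F => tr a ≠ 0)
    (fun a ha => ⟨fun h => (Finset.mem_filter.1 ha).2 (by rw [h, map_zero]),
      (if_neg (Finset.mem_filter.1 ha).2).symm⟩)
    (E := -9 * s ^ 3) (u := 27 * (s : ℚ) ^ 4 - 9 * s ^ 3)
    (v := 27 * (s : ℚ) ^ 4 + 9 * s ^ 3) (by push_cast; linear_combination h1q / 9)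
    (by rw [card_filter_trace_ne_zero hA]; push_cast; rw [hAq]; ring)
    (by rw [card_filter_trace_ne_zero hA]; push_cast; rw [hAq]; ring)
  rw [weightEnumerator_traceCode hA hA0 hf, e0, e1,
    show 27 * (s : ℚ) ^ 4 - 3 * A + 2 * (9 * s ^ 3)
      = 2 * ((27 * (s : ℚ) ^ 4 - 3 * A) / 2 + 9 * s ^ 3) by ring,
    show 27 * (s : ℚ) ^ 4 - 3 * A - 2 * (9 * s ^ 3)
      = 2 * ((27 * (s : ℚ) ^ 4 - 3 * A) / 2 - 9 * s ^ 3) by ring]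
  simp only [C_mul (a := (2 : ℚ)), add_zero]
  rw [show (C (2 : ℚ) : ℚ[X]) = 2 from rfl]
  ring

end Distribution
-- Assembly of the two parities
theorem theorem2 {F : Type*} [Field F] [Fintype F] [Algebra (ZMod 3) F] (m k : ℕ)
    (hF : Fintype.card F = 3 ^ m) (hk : Odd k) (hmk : Nat.gcd m k = 1)
    (f : F → F) (hf : ∀ x, f x = x ^ ((3 ^ k + 1) / 2)) :
    (Odd m →
      IsLinearCode (traceCode 3 f) (3 ^ m + 1) (2 * m + 1) ∧
      (m ≠ 1 → HasMinDist (traceCode 3 f) (2 * 3 ^ (m - 1) - 3 ^ ((m - 1) / 2))) ∧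
      (m = 1 → HasMinDist (traceCode 3 f) 2) ∧
      weightEnumerator (traceCode 3 f) =
        1 + C 2 * X ^ (3 ^ m)
        + C (3 ^ (2 * m - 1) + 2 * 3 ^ m - 3) * X ^ (2 * 3 ^ (m - 1))
        + C ((3 ^ m - 3 ^ (m - 1)) * 3 ^ m) * X ^ (2 * 3 ^ (m - 1) + 1)
        + C ((3 ^ (m - 1) - 1) * 3 ^ m) * X ^ (2 * 3 ^ (m - 1) + 3 ^ ((m - 1) / 2))
        + C ((3 ^ (m - 1) - 1) * 3 ^ m) * X ^ (2 * 3 ^ (m - 1) - 3 ^ ((m - 1) / 2))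
        + C ((3 ^ m - 3 ^ (m - 1)) * 3 ^ m) * X ^ (2 * 3 ^ (m - 1) + 3 ^ ((m - 1) / 2) + 1)
        + C ((3 ^ m - 3 ^ (m - 1)) * 3 ^ m) * X ^ (2 * 3 ^ (m - 1) - 3 ^ ((m - 1) / 2) + 1) ∧
      IsLinearCode (dualCode (traceCode 3 f)) (3 ^ m + 1) (3 ^ m - 2 * m) ∧
      HasMinDist (dualCode (traceCode 3 f)) 4) ∧
    (Even m →
      IsLinearCode (traceCode 3 f) (3 ^ m + 1) (2 * m + 1) ∧
      HasMinDist (traceCode 3 f) (2 * 3 ^ (m - 1) - 2 * 3 ^ ((m - 2) / 2)) ∧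
      weightEnumerator (traceCode 3 f) =
        1 + C 2 * X ^ (3 ^ m)
        + C (3 * (3 ^ m - 1)) * X ^ (2 * 3 ^ (m - 1))
        + C ((3 ^ (2 * m - 1) - 3 ^ m) / 2 - 3 ^ ((3 * m - 2) / 2))
            * X ^ (2 * (3 ^ (m - 1) + 3 ^ ((m - 2) / 2)))
        + C ((3 ^ (2 * m - 1) - 3 ^ m) / 2 + 3 ^ ((3 * m - 2) / 2))
            * X ^ (2 * (3 ^ (m - 1) - 3 ^ ((m - 2) / 2)))
        + C (3 ^ (2 * m - 1) + 3 ^ ((3 * m - 2) / 2))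
            * X ^ (2 * (3 ^ (m - 1) + 3 ^ ((m - 2) / 2)) + 1)
        + C (3 ^ (2 * m - 1) - 3 ^ ((3 * m - 2) / 2))
            * X ^ (2 * (3 ^ (m - 1) - 3 ^ ((m - 2) / 2)) + 1)
        + C (3 ^ (2 * m - 1) - 3 ^ m + 2 * 3 ^ ((3 * m - 2) / 2))
            * X ^ (2 * 3 ^ (m - 1) + 3 ^ ((m - 2) / 2))
        + C (3 ^ (2 * m - 1) - 3 ^ m - 2 * 3 ^ ((3 * m - 2) / 2))
            * X ^ (2 * 3 ^ (m - 1) - 3 ^ ((m - 2) / 2))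
        + C (2 * (3 ^ (2 * m - 1) - 3 ^ ((3 * m - 2) / 2)))
            * X ^ (2 * 3 ^ (m - 1) + 3 ^ ((m - 2) / 2) + 1)
        + C (2 * (3 ^ (2 * m - 1) + 3 ^ ((3 * m - 2) / 2)))
            * X ^ (2 * 3 ^ (m - 1) - 3 ^ ((m - 2) / 2) + 1) ∧
      IsLinearCode (dualCode (traceCode 3 f)) (3 ^ m + 1) (3 ^ m - 2 * m) ∧
      HasMinDist (dualCode (traceCode 3 f)) 4) := by

  classical
  have hchar : CharP F 3 := charP_of_injective_algebraMap (algebraMap (ZMod 3) F).injective 3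
  obtain ⟨d, hd⟩ : ∃ d, 3 ^ k + 1 = 2 * d := by
    have h : Odd (3 ^ k) := Odd.pow (by decide)
    obtain ⟨e, he⟩ := h
    exact ⟨e + 1, by omega⟩
  have hev := even_half_three_pow_add_one hk hd
  obtain rfl : f = fun x => x ^ d := by
    funext x
    rw [hf, hd, Nat.mul_div_cancel_left d two_pos]
  have hpl : IsPlanar fun x : F => x ^ d := isPlanar_pow hF hk hmk hd
  have hm0 : m ≠ 0 := by
    rintro rfl
    exact absurd hF (Fintype.one_lt_card (α := F)).ne'
  have hA : Fintype.card F = 3 * 3 ^ (m - 1) := by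
    rw [hF, ← pow_succ', Nat.sub_add_cancel (Nat.pos_of_ne_zero hm0)]
  have hA0 : 0 < 3 ^ (m - 1) := by positivity
  have hcard : Fintype.card (F ⊕ Unit) = 3 ^ m + 1 := by
    rw [Fintype.card_sum, hF, Fintype.card_unit]
  have hdim := finrank_traceCode hF hA hA0 hpl
  have hcode : IsLinearCode (traceCode 3 fun x : F => x ^ d) (3 ^ m + 1) (2 * m + 1) :=
    ⟨hcard, hdim⟩
  have hdual : IsLinearCode (dualCode (traceCode 3 fun x : F => x ^ d)) (3 ^ m + 1)
      (3 ^ m - 2 * m) := by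
    refine ⟨hcard, ?_⟩
    have := finrank_add_finrank_dualCode (traceCode 3 fun x : F => x ^ d)
    omega
  have hd0 : d ≠ 0 := by rintro rfl; simp at hd
  have hdualdist : HasMinDist (dualCode (traceCode 3 fun x : F => x ^ d)) 4 :=
    hasMinDist_dualCode_traceCode hpl (zero_pow hd0) (one_pow d) hev.neg_one_pow
  constructor
  · rintro ⟨l, rfl⟩
    simp only [Nat.add_sub_cancel, Nat.mul_div_cancel_left l two_pos] at hA hA0 ⊢
    refine ⟨hcode, ?_, ?_, ?_, hdual, hdualdist⟩
    · intro hm1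
      exact hasMinDist_traceCode_of_odd rfl rfl hA (Nat.one_lt_pow (by omega) (by norm_num)) hpl
    · intro hm1
      obtain rfl : l = 0 := by omega
      exact hasMinDist_traceCode_of_card_eq_three hA hpl
    · rw [weightEnumerator_traceCode_of_odd rfl rfl hA hA0 hpl]
      have e1 : (3 : ℚ) ^ (2 * (2 * l + 1) - 1) = 3 * ((3 ^ (2 * l) : ℕ) : ℚ) ^ 2 := by
        rw [show 2 * (2 * l + 1) - 1 = 2 * l * 2 + 1 by omega, pow_succ, pow_mul]
        push_cast
        ring
      have e2 : (3 : ℚ) ^ (2 * l + 1) = 3 * ((3 ^ (2 * l) : ℕ) : ℚ) := by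
        push_cast; ring
      have e3 : (3 : ℚ) ^ (2 * l) = ((3 ^ (2 * l) : ℕ) : ℚ) := by push_cast; rfl
      have e4 : (3 : ℕ) ^ (2 * l + 1) = 3 * 3 ^ (2 * l) := pow_succ' _ _
      rw [e1, e2, e3, e4]
  · intro hm
    -- m ≠ 0, so none of the exponents m - 1, (m - 2)/2, (3m - 2)/2 is truncated.
    obtain ⟨l, rfl⟩ : ∃ l, m = 2 * l + 2 := by
      obtain ⟨j, rfl⟩ := hm
      exact ⟨j - 1, by omega⟩
    obtain ⟨i, hi⟩ : ∃ i : F, i ^ 2 = -1 := by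
      have h : IsSquare (-1 : F) := by
        rw [FiniteField.isSquare_neg_one_iff, hF, show 2 * l + 2 = 2 * (l + 1) by ring, pow_mul,
          Nat.pow_mod]
        norm_num
      obtain ⟨i, hi⟩ := h
      exact ⟨i, by rw [hi, sq]⟩
    rw [show 2 * l + 2 - 1 = 2 * l + 1 by omega] at hA hA0 ⊢
    have h0 := sum_levelProd_trace_eq_zero hA hA0 hk hd hpl hi
    have h1 := sum_levelProd_trace_ne_zero hA hk hd hpl hi
    rw [show (2 * l + 2 - 2) / 2 = l by omega]
    refine ⟨hcode, ?_, ?_, hdual, hdualdist⟩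
    · refine hasMinDist_traceCode_of_even rfl rfl hA hpl ?_
      -- The sum of `levelProd` over Tr a = 0 is positive, so some pair attains the deviation 2s.
      by_contra! h
      have hle : ∑ a with a ≠ 0 ∧ Algebra.trace (ZMod 3) F a = 0,
          ∑ b, levelProd (3 ^ (2 * l + 1)) (fun x : F => x ^ d) a b ≤ 0 :=
        Finset.sum_nonpos fun a ha => Finset.sum_nonpos fun b _ =>
          h a b (Finset.mem_filter.1 ha).2.1 (Finset.mem_filter.1 ha).2.2
      have hpos : (0 : ℤ) < 12 * ((3 ^ (2 * l + 1) : ℕ) : ℤ) ^ 3 := by positivity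
      linarith
    · rw [weightEnumerator_traceCode_of_even rfl rfl hA hA0 hpl h0 h1]
      have e1 : (3 : ℚ) ^ (2 * (2 * l + 2) - 1) = 27 * ((3 ^ l : ℕ) : ℚ) ^ 4 := by
        rw [show 2 * (2 * l + 2) - 1 = l * 4 + 3 by omega, pow_add, pow_mul]
        push_cast
        ring
      have e2 : (3 : ℚ) ^ (2 * l + 2) = 3 * ((3 ^ (2 * l + 1) : ℕ) : ℚ) := by
        push_cast; ring
      have e3 : (3 : ℚ) ^ ((3 * (2 * l + 2) - 2) / 2) = 9 * ((3 ^ l : ℕ) : ℚ) ^ 3 := by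
        rw [show (3 * (2 * l + 2) - 2) / 2 = l * 3 + 2 by omega, pow_add, pow_mul]
        push_cast
        ring
      have e4 : (3 : ℕ) ^ (2 * l + 2) = 3 * 3 ^ (2 * l + 1) := pow_succ' _ _
      rw [e1, e2, e3, e4]
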